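/- **Setting.** Let $(X_0,X_1)$ be an interpolation couple, i.e. two Banach spaces continuously embedded in the same Hausdorff topological vector space. Let $X_0\cap X_1$ and $X_0+X_1$ carry the norms $\max(\|a\|_{X_0},\|a\|_{X_1})$ and $\inf\{\|a_0\|_{X_0}+\|a_1\|_{X_1}: a=a_0+a_1,\ a_i\in X_i\}$. For $t>0$ put $$K(t,a)=\inf\{\|a_0\|_{X_0}+t\|a_1\|_{X_1}: a=a_0+a_1,\ a_i\in X_i\}\quad(a\in X_0+X_1),\qquad J(t,a)=\max(\|a\|_{X_0},t\|a\|_{X_1})\quad(a\in X_0\cap X_1).$$ For $p\in(1,\infty)$, a function $\phi:\mathbb R_+\to\mathbb R_+$ and a measurable $F:\mathbb R_+=(0,\infty)\to[0,\infty]$ put $\Phi^\phi_p(F)=\big(\int_0^\infty(\phi(t^{-1})F(t))^p\,\frac{dt}{t}\big)^{1/p}$, and let $$(X_0,X_1)_{\phi,p}=\{a\in X_0+X_1:\ \|a\|_{(X_0,X_1)_{\phi,p}}:=\Phi^\phi_p(K(\cdot,a))<\infty\}.$$ A weight $w:\mathbb R\to[0,\infty)$ (measurable, positive a.e.) belongs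 to $A_p$ if $$[w]_{A_p}=\sup_{a<b}\Big(\frac1{b-a}\int_a^b w\,dt\Big)\Big(\frac1{b-a}\int_a^b w^{-1/(p-1)}\,dt\Big)^{p-1}<\infty .$$ Write $W(t)=\int_0^t w(s)\,ds$, and $\|g\|_{L_p(\mathbb R_+,w\,dt;X)}=\big(\int_0^\infty\|g(t)\|_X^p\,w(t)\,dt\big)^{1/p}$. **Theorem (extension theorem with local derivative).** Let $p\in(1,\infty)$. For each value of $[w]_{A_p}$ there is a constant $N=N(p,[w]_{A_p})$ such that for every interpolation couple $(X_0,X_1)$, every $w\in A_p$ and every $a\in(X_0,X_1)_{W^{1/p},p}$ there exist $u:[0,\infty)\to X_0+X_1$ with $u|_{\mathbb R_+}\in L_p(\mathbb R_+,w\,dt;X_0)$ and $f\in L_p(\mathbb R_+,w\,dt;X_1)$, with $f$ integrable on $(0,t)$ for every $t>0$, such that $u(0)=a$ and $$u(t)=a+\int_0^t f(s)\,ds\qquad\text{for all }t>0,$$ and $$\|u\|_{L_p(\mathbb R_+,w\,dt;X_0)}+\|f\|_{L_p(\mathbb R_+,w\,dt;X_1)}\le N\,\|a\|_{(X_0,X_1)_{W^{1/p},p}}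 .$$ Moreover, $u$ can be chosen of the form $$u(t)=\int_0^\infty e^{-t\lambda}v(\lambda)\,\frac{d\lambda}{\lambda}\qquad(t\ge0),$$ where $v:\mathbb R_+\to X_0\cap X_1$ is strongly measurable, $a=\int_0^\infty v(\lambda)\,\frac{d\lambda}{\lambda}$ and $\Phi^{W^{1/p}}_p\big(J(\cdot,v(\cdot))\big)\le N\,\|a\|_{(X_0,X_1)_{W^{1/p},p}}$; these integrals are Bochner integrals in $X_0+X_1$. -/

import Mathlib

open MeasureTheory Set
open scoped ENNReal NNReal

noncomputable section

/-- An interpolation couple: two (Banach) spaces continuously embedded in the same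
(Hausdorff) topological vector space `Z`. -/
structure InterpolationCouple (X₀ X₁ Z : Type*)
    [NormedAddCommGroup X₀] [NormedSpace ℝ X₀] [NormedAddCommGroup X₁] [NormedSpace ℝ X₁]
    [AddCommGroup Z] [Module ℝ Z] [TopologicalSpace Z] where
  /-- the embedding of `X₀` in `Z` -/
  emb₀ : X₀ →L[ℝ] Z
  /-- the embedding of `X₁` in `Z` -/
  emb₁ : X₁ →L[ℝ] Z
  emb₀_injective : Function.Injective emb₀
  emb₁_injective : Function.Injective emb₁

namespace InterpolationCouple

variable {X₀ X₁ Z : Type*}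
  [NormedAddCommGroup X₀] [NormedSpace ℝ X₀] [NormedAddCommGroup X₁] [NormedSpace ℝ X₁]
  [AddCommGroup Z] [Module ℝ Z] [TopologicalSpace Z] [IsTopologicalAddGroup Z]

/-- The map `(x₀, x₁) ↦ x₀ + x₁` into `Z`, on the product with norm `‖x₀‖ + ‖x₁‖`. -/
def addMap (C : InterpolationCouple X₀ X₁ Z) : WithLp 1 (X₀ × X₁) →L[ℝ] Z :=
  (C.emb₀.coprod C.emb₁).comp
    (WithLp.prodContinuousLinearEquiv 1 ℝ X₀ X₁ : WithLp 1 (X₀ × X₁) →L[ℝ] X₀ × X₁)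

/-- The kernel of `(x₀, x₁) ↦ x₀ + x₁`. -/
def addKer (C : InterpolationCouple X₀ X₁ Z) : Submodule ℝ (WithLp 1 (X₀ × X₁)) :=
  LinearMap.ker (C.addMap : WithLp 1 (X₀ × X₁) →ₗ[ℝ] Z)

instance isClosed_addKer [T2Space Z] (C : InterpolationCouple X₀ X₁ Z) :
    IsClosed (C.addKer : Set (WithLp 1 (X₀ × X₁))) :=
  C.addMap.isClosed_ker

/-- The space `X₀ + X₁ ⊆ Z`, realized as the quotient of `X₀ × X₁` by the kernel of addition into
`Z`; the quotient norm is the infimum of `‖a₀‖ + ‖a₁‖` over all decompositions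
`a = a₀ + a₁` (see `toZ_injective`, `range_toZ` and `norm_eq_sInf`). -/
abbrev SumSpace (C : InterpolationCouple X₀ X₁ Z) : Type _ := WithLp 1 (X₀ × X₁) ⧸ C.addKer

/-- The embedding `X₀ ⊆ X₀ + X₁`. -/
def inl (C : InterpolationCouple X₀ X₁ Z) : X₀ →ₗ[ℝ] C.SumSpace :=
  C.addKer.mkQ ∘ₗ (WithLp.linearEquiv 1 ℝ (X₀ × X₁)).symm.toLinearMap ∘ₗ LinearMap.inl ℝ X₀ X₁

/-- The embedding `X₁ ⊆ X₀ + X₁`. -/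
def inr (C : InterpolationCouple X₀ X₁ Z) : X₁ →ₗ[ℝ] C.SumSpace :=
  C.addKer.mkQ ∘ₗ (WithLp.linearEquiv 1 ℝ (X₀ × X₁)).symm.toLinearMap ∘ₗ LinearMap.inr ℝ X₀ X₁

/-- The inclusion of `X₀ + X₁` in `Z`. -/
def toZ (C : InterpolationCouple X₀ X₁ Z) : C.SumSpace →ₗ[ℝ] Z :=
  C.addKer.liftQ (C.addMap : WithLp 1 (X₀ × X₁) →ₗ[ℝ] Z) le_rfl

theorem toZ_injective (C : InterpolationCouple X₀ X₁ Z) : Function.Injective C.toZ :=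
  LinearMap.ker_eq_bot.mp (Submodule.ker_liftQ_eq_bot _ _ le_rfl le_rfl)

@[simp] theorem toZ_inl (C : InterpolationCouple X₀ X₁ Z) (x : X₀) :
    C.toZ (C.inl x) = C.emb₀ x := by
  simp [toZ, inl, addMap]

@[simp] theorem toZ_inr (C : InterpolationCouple X₀ X₁ Z) (x : X₁) :
    C.toZ (C.inr x) = C.emb₁ x := by
  simp [toZ, inr, addMap]

theorem mk_eq_inl_add_inr (C : InterpolationCouple X₀ X₁ Z) (x : WithLp 1 (X₀ × X₁)) :
    (Submodule.Quotient.mk x : C.SumSpace) = C.inl x.fst + C.inr x.snd := by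
  apply C.toZ_injective
  rw [map_add, toZ_inl, toZ_inr]
  simp [toZ, addMap]

/-- As a subset of `Z`, the space `X₀ + X₁` consists of the sums `x₀ + x₁`. -/
theorem range_toZ (C : InterpolationCouple X₀ X₁ Z) :
    Set.range C.toZ = {z | ∃ x₀ x₁, z = C.emb₀ x₀ + C.emb₁ x₁} := by
  ext z
  constructor
  · rintro ⟨a, rfl⟩
    obtain ⟨x, rfl⟩ := Submodule.Quotient.mk_surjective _ a
    exact ⟨x.fst, x.snd, by rw [mk_eq_inl_add_inr, map_add, toZ_inl, toZ_inr]⟩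
  · rintro ⟨x₀, x₁, rfl⟩
    exact ⟨C.inl x₀ + C.inr x₁, by rw [map_add, toZ_inl, toZ_inr]⟩

/-- The norm of `X₀ + X₁`. -/
theorem norm_eq_sInf [T2Space Z] (C : InterpolationCouple X₀ X₁ Z) (a : C.SumSpace) :
    ‖a‖ = sInf {r | ∃ x₀ x₁, a = C.inl x₀ + C.inr x₁ ∧ r = ‖x₀‖ + ‖x₁‖} := by
  have hle (r : ℝ) : r ≤ ‖a‖ ↔ ∀ m, (Submodule.Quotient.mk m : C.SumSpace) = a → r ≤ ‖m‖ :=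
    QuotientAddGroup.le_norm_iff (S := C.addKer.toAddSubgroup) (x := a)
  refine (IsGLB.csInf_eq ⟨?_, ?_⟩ ?_).symm
  · rintro r ⟨x₀, x₁, h, rfl⟩
    have := (hle ‖a‖).1 le_rfl (WithLp.toLp 1 (x₀, x₁)) (by rw [mk_eq_inl_add_inr]; exact h.symm)
    simpa [WithLp.prod_norm_eq_of_L1] using this
  · intro r hr
    refine (hle r).2 fun m hm => hr ⟨m.fst, m.snd, ?_, ?_⟩
    · rw [← mk_eq_inl_add_inr]; exact hm.symm
    · simp [WithLp.prod_norm_eq_of_L1]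
  · obtain ⟨m, hm⟩ := Submodule.Quotient.mk_surjective _ a
    exact ⟨_, m.fst, m.snd, by rw [← mk_eq_inl_add_inr]; exact hm.symm, rfl⟩

/-- The space `X₀ ∩ X₁`, realized as the pairs `(x₀, x₁)` with the same image in `Z`;
its norm, inherited from the product, is `max ‖x₀‖ ‖x₁‖`. -/
def interSpace (C : InterpolationCouple X₀ X₁ Z) : Submodule ℝ (X₀ × X₁) :=
  LinearMap.ker (C.emb₀.coprod (-C.emb₁) : X₀ × X₁ →ₗ[ℝ] Z)

theorem mem_interSpace (C : InterpolationCouple X₀ X₁ Z) (x : X₀ × X₁) :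
    x ∈ C.interSpace ↔ C.emb₀ x.1 = C.emb₁ x.2 := by
  simp [interSpace, ← sub_eq_add_neg, sub_eq_zero]

/-- The embedding `X₀ ∩ X₁ ⊆ X₀ + X₁`. -/
def ofInter (C : InterpolationCouple X₀ X₁ Z) : C.interSpace →ₗ[ℝ] C.SumSpace :=
  C.inl ∘ₗ LinearMap.fst ℝ X₀ X₁ ∘ₗ C.interSpace.subtype

theorem ofInter_eq_inr (C : InterpolationCouple X₀ X₁ Z) (x : C.interSpace) :
    C.ofInter x = C.inr (x : X₀ × X₁).2 := by
  apply C.toZ_injective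
  rw [toZ_inr, ← (C.mem_interSpace _).1 x.2]
  simp [ofInter]

/-- The functional `K(t, a) = inf {‖a₀‖ + t ‖a₁‖ : a = a₀ + a₁}`. -/
def K (C : InterpolationCouple X₀ X₁ Z) (t : ℝ) (a : C.SumSpace) : ℝ≥0∞ :=
  ⨅ (x₀ : X₀) (x₁ : X₁) (_ : a = C.inl x₀ + C.inr x₁), ‖x₀‖ₑ + ENNReal.ofReal t * ‖x₁‖ₑ

/-- The functional `J(t, a) = max (‖a‖_{X₀}) (t ‖a‖_{X₁})` on `X₀ ∩ X₁`. -/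
def J (C : InterpolationCouple X₀ X₁ Z) (t : ℝ) (a : C.interSpace) : ℝ≥0∞ :=
  max ‖(a : X₀ × X₁).1‖ₑ (ENNReal.ofReal t * ‖(a : X₀ × X₁).2‖ₑ)

end InterpolationCouple

/-- `(∫₀^∞ (φ(t⁻¹) F(t))^p dt/t)^{1/p}`. -/
def interpFunctional (φ : ℝ → ℝ≥0∞) (p : ℝ) (F : ℝ → ℝ≥0∞) : ℝ≥0∞ :=
  (∫⁻ t in Ioi (0 : ℝ), (φ t⁻¹ * F t) ^ p * ENNReal.ofReal t⁻¹) ^ (1 / p)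

namespace InterpolationCouple

variable {X₀ X₁ Z : Type*}
  [NormedAddCommGroup X₀] [NormedSpace ℝ X₀] [NormedAddCommGroup X₁] [NormedSpace ℝ X₁]
  [AddCommGroup Z] [Module ℝ Z] [TopologicalSpace Z] [IsTopologicalAddGroup Z]

/-- The norm of `(X₀, X₁)_{φ,p}` given by the `K`-method, with value `∞` off the space. -/
def interpNorm (C : InterpolationCouple X₀ X₁ Z) (φ : ℝ → ℝ≥0∞) (p : ℝ) (a : C.SumSpace) : ℝ≥0∞ :=
  interpFunctional φ p (fun t => C.K t a)

/-- The interpolation space `(X₀, X₁)_{φ,p}` (as a subset of `X₀ + X₁`). -/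
def interpSpace (C : InterpolationCouple X₀ X₁ Z) (φ : ℝ → ℝ≥0∞) (p : ℝ) : Set C.SumSpace :=
  {a | C.interpNorm φ p a < ∞}

/-- `v : (0,∞) → X₀ ∩ X₁` is strongly measurable and `a = ∫₀^∞ v(t) dt/t` as a Bochner integral
in `X₀ + X₁`. -/
structure IsJRepresentation [T2Space Z] (C : InterpolationCouple X₀ X₁ Z)
    (v : ℝ → C.interSpace) (a : C.SumSpace) : Prop where
  aestronglyMeasurable : AEStronglyMeasurable v (volume.restrict (Ioi 0))
  integrableOn : IntegrableOn (fun t : ℝ => t⁻¹ • C.ofInter (v t)) (Ioi 0)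
  integral_eq : a = ∫ t in Ioi (0 : ℝ), t⁻¹ • C.ofInter (v t)

end InterpolationCouple

/-- The Muckenhoupt constant `[w]_{A_p}` of a weight on the real line. -/
def muckenhouptConst (p : ℝ) (w : ℝ → ℝ≥0) : ℝ≥0∞ :=
  ⨆ (a : ℝ) (b : ℝ) (_ : a < b),
    ((ENNReal.ofReal (b - a))⁻¹ * ∫⁻ t in Icc a b, (w t : ℝ≥0∞)) *
      ((ENNReal.ofReal (b - a))⁻¹ * ∫⁻ t in Icc a b, (w t : ℝ≥0∞) ^ (-(1 / (p - 1)))) ^ (p - 1)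

/-- The class `A_p` on the real line. As usual a weight is positive almost everywhere; given that
the constant is finite, this only excludes `w = 0` a.e., for which the convention `0 * ∞ = 0` would
give the constant `0`. -/
structure IsMuckenhoupt (p : ℝ) (w : ℝ → ℝ≥0) : Prop where
  aemeasurable : AEMeasurable w
  ae_pos : ∀ᵐ t, 0 < w t
  const_lt_top : muckenhouptConst p w < ∞

/-- `W(t) = ∫₀ᵗ w(s) ds` for `t > 0`. -/
def weightPrimitive (w : ℝ → ℝ≥0) (t : ℝ) : ℝ≥0∞ := ∫⁻ s in Ioc 0 t, (w s : ℝ≥0∞)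

/-- The measure `w dt` on `(0,∞)`. -/
def weightMeasure (w : ℝ → ℝ≥0) : Measure ℝ :=
  (volume.restrict (Ioi 0)).withDensity (fun t => (w t : ℝ≥0∞))

end

noncomputable section

/-! The fundamental lemma (`exists_isJRepresentation`) writes `a = ∫ v(λ) dλ/λ` with `J(λ, v(λ)) ≤
16 K(λ, a)`, and `u` is the Laplace transform of `v` with respect to `dλ/λ`. The `J` bound gives
`‖v(λ)‖ ≤ 16 K(λ, a)` in `X₀` and `‖v(λ)‖ ≤ 16 K(λ, a)/λ` in `X₁`; differentiating `e^{-tλ}` costs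
exactly the factor `λ` gained in `X₁`. Hence `‖u(t)‖` in `X₀` and `‖u'(t)‖` in `X₁` are both at most
`16 B(t)`, where `B(t) = ∫ e^{-tλ} K(λ, a) dλ/λ`, and what remains is a scalar estimate of `B` in
`L_p(w)`.

Since `K` is nondecreasing and `K(λ)/λ` nonincreasing, `B(t) ≤ 2 ∑ₖ K(2⁻ᵏ/t)` (`laplaceLog_le`).
Tonelli bounds `∫ K(c/t)^p w dt` by the interpolation integral with `W(1/r)` replaced by `W(c/r)`
(`lintegral_rpow_comp_inv_le`). The `A_p` condition yields reverse doubling, `W(2⁻ᵏ s) ≤ θᵏ W(s)`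
with `θ < 1` depending only on `p` and the constant of `w`, so Minkowski's inequality leaves a
geometric series.

By Hölder, and because `w^{-1/(p-1)}` is locally integrable, `B` is also integrable on every
`(0,T]`. This gives the convergence needed throughout: the hypothesis of the fundamental lemma, the
integrals defining `u` in `X₀`, and Fubini for `u(t) - a = ∫₀ᵗ f`. -/

theorem ENNReal.lintegral_Lp_tsum_le {α : Type*} [MeasurableSpace α] {μ : Measure α} {p : ℝ}
    (hp : 1 ≤ p) {F : ℕ → α → ℝ≥0∞} (hF : ∀ k, Measurable (F k)) :
    (∫⁻ x, (∑' k, F k x) ^ p ∂μ) ^ (1 / p) ≤ ∑' k, (∫⁻ x, F k x ^ p ∂μ) ^ (1 / p) := by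
  have hp0 : 0 < p := by linarith
  have hfin (n : ℕ) : (∫⁻ x, (∑ k ∈ Finset.range n, F k x) ^ p ∂μ) ^ (1 / p) ≤
      ∑ k ∈ Finset.range n, (∫⁻ x, F k x ^ p ∂μ) ^ (1 / p) := by
    induction n with
    | zero => simp [hp0]
    | succ n ih =>
      simp only [Finset.sum_range_succ]
      refine (ENNReal.lintegral_Lp_add_le (f := fun x => ∑ k ∈ Finset.range n, F k x)
        (g := F n) ?_ ?_ hp).trans (by gcongr)
      · exact (Finset.measurable_fun_sum _ fun k _ => hF k).aemeasurable
      · exact (hF n).aemeasurable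
  simp only [one_div]
  simp only [one_div] at hfin
  rw [ENNReal.rpow_inv_le_iff hp0]
  have hlim : ∀ x, (∑' k, F k x) ^ p = ⨆ n, (∑ k ∈ Finset.range n, F k x) ^ p := fun x => by
    rw [ENNReal.tsum_eq_iSup_nat]
    exact (ENNReal.orderIsoRpow p hp0).map_iSup _
  simp_rw [hlim]
  rw [lintegral_iSup]
  · refine iSup_le fun n => ?_
    have h := ENNReal.rpow_le_rpow (hfin n) hp0.le
    rw [← ENNReal.rpow_mul, inv_mul_cancel₀ hp0.ne', ENNReal.rpow_one] at h
    refine h.trans (ENNReal.rpow_le_rpow ?_ hp0.le)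
    exact ENNReal.sum_le_tsum (f := fun k => (∫⁻ x, F k x ^ p ∂μ) ^ p⁻¹) (Finset.range n)
  · exact fun n => (Finset.measurable_fun_sum _ fun k _ => hF k).pow_const _
  · intro m n hmn x
    dsimp only
    gcongr

/-! ### Laplace transforms of quasiconcave functions -/

/-- The Laplace transform on `(0,∞)` with respect to `dλ/λ`. -/
def laplaceLog (D : ℝ → ℝ≥0∞) (t : ℝ) : ℝ≥0∞ :=
  ∫⁻ r in Ioi (0 : ℝ), ENNReal.ofReal (Real.exp (-(t * r))) * (D r * ENNReal.ofReal r⁻¹)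

/-- A nondecreasing function for which `D r / r` is nonincreasing on `(0,∞)`. -/
structure IsQuasiconcave (D : ℝ → ℝ≥0∞) : Prop where
  monotone : Monotone D
  le_mul : ∀ ⦃s t : ℝ⦄, 0 < s → s ≤ t → D t ≤ ENNReal.ofReal (t / s) * D s

theorem antitone_laplaceLog (D : ℝ → ℝ≥0∞) : Antitone (laplaceLog D) := by
  intro s t hst
  refine setLIntegral_mono' measurableSet_Ioi fun r hr => ?_
  gcongr
  exact le_of_lt hr

theorem ae_pos_weightMeasure (w : ℝ → ℝ≥0) : ∀ᵐ t ∂weightMeasure w, 0 < t :=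
  (withDensity_absolutelyContinuous _ _).ae_le (ae_restrict_mem measurableSet_Ioi)

instance sFinite_weightMeasure (w : ℝ → ℝ≥0) : SFinite (weightMeasure w) := by
  unfold weightMeasure; infer_instance

theorem weightMeasure_Ioc (w : ℝ → ℝ≥0) (t : ℝ) :
    weightMeasure w (Ioc 0 t) = weightPrimitive w t := by
  rw [weightMeasure, withDensity_apply _ measurableSet_Ioc,
    Measure.restrict_restrict measurableSet_Ioc,
    inter_eq_left.2 Ioc_subset_Ioi_self, weightPrimitive]

theorem lintegral_exp_neg_mul_mul {t : ℝ} (ht : 0 < t) :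
    ∫⁻ r in Ioi (0 : ℝ), ENNReal.ofReal (Real.exp (-(t * r)) * t) = 1 := by
  have hi : IntegrableOn (fun r : ℝ => Real.exp (-(t * r)) * t) (Ioi 0) := by
    simpa [neg_mul, IntegrableOn] using (integrableOn_exp_mul_Ioi (neg_lt_zero.2 ht) 0).mul_const t
  rw [← ofReal_integral_eq_lintegral_ofReal hi (ae_of_all _ fun r => by positivity),
    integral_mul_const]
  have := integral_exp_mul_Ioi (neg_lt_zero.2 ht) 0
  simp only [neg_mul] at this
  rw [this]
  simp [ht.ne']

namespace IsQuasiconcave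

variable {D : ℝ → ℝ≥0∞}

/-- Beyond `1/t`, `D r ≤ r t D(1/t)` cancels the `1/r`, and the exponential has total mass one.
Below `1/t` the exponential is dropped, `D` is frozen at the right end of each dyadic block, and
`dr/r` gives a block mass at most one. -/
theorem laplaceLog_le (hD : IsQuasiconcave D) {t : ℝ} (ht : 0 < t) :
    laplaceLog D t ≤ 2 * ∑' k : ℕ, D ((1 / 2) ^ k * t⁻¹) := by
  have hcov : Ioi (0 : ℝ) ⊆ Ioi t⁻¹ ∪ ⋃ k : ℕ, Ioc ((1 / 2) ^ (k + 1) * t⁻¹) ((1 / 2) ^ k * t⁻¹) := by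
    intro r hr
    have hr : 0 < r := hr
    by_cases h : t⁻¹ < r
    · exact Or.inl h
    · push Not at h
      obtain ⟨n, hn1, hn2⟩ := exists_nat_pow_near_of_lt_one (x := r * t) (y := (1 / 2 : ℝ))
        (by positivity) (by rwa [← le_div_iff₀ ht, one_div]) (by norm_num) (by norm_num)
      refine Or.inr (mem_iUnion.2 ⟨n, ?_, ?_⟩)
      · rwa [← div_eq_mul_inv, div_lt_iff₀ ht]
      · rwa [← div_eq_mul_inv, le_div_iff₀ ht]
  have h1 : ∫⁻ r in Ioi t⁻¹, ENNReal.ofReal (Real.exp (-(t * r))) * (D r * ENNReal.ofReal r⁻¹) ≤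
      D t⁻¹ := by
    calc _ ≤ ∫⁻ r in Ioi t⁻¹, D t⁻¹ * ENNReal.ofReal (Real.exp (-(t * r)) * t) := by
          refine setLIntegral_mono' measurableSet_Ioi fun r hr => ?_
          have hr : t⁻¹ < r := hr
          have hti : 0 < t⁻¹ := inv_pos.2 ht
          have hr0 : 0 < r := hti.trans hr
          calc _ ≤ ENNReal.ofReal (Real.exp (-(t * r))) *
                ((ENNReal.ofReal (r / t⁻¹) * D t⁻¹) * ENNReal.ofReal r⁻¹) := by
                gcongr
                exact hD.le_mul hti hr.le
            _ = _ := by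
                rw [mul_right_comm (ENNReal.ofReal (r / t⁻¹)), ← ENNReal.ofReal_mul (by positivity),
                  ← mul_assoc, ← ENNReal.ofReal_mul (by positivity), mul_comm]
                congr 3
                field_simp
      _ ≤ ∫⁻ r in Ioi 0, D t⁻¹ * ENNReal.ofReal (Real.exp (-(t * r)) * t) :=
          lintegral_mono_set (Ioi_subset_Ioi (inv_pos.2 ht).le)
      _ = D t⁻¹ := by
          rw [lintegral_const_mul _ (by fun_prop), lintegral_exp_neg_mul_mul ht, mul_one]
  have h2 (k : ℕ) : ∫⁻ r in Ioc ((1 / 2) ^ (k + 1) * t⁻¹) ((1 / 2) ^ k * t⁻¹),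
      ENNReal.ofReal (Real.exp (-(t * r))) * (D r * ENNReal.ofReal r⁻¹) ≤
        D ((1 / 2) ^ k * t⁻¹) := by
    have hpos : 0 < (1 / 2) ^ (k + 1) * t⁻¹ := by positivity
    calc _ ≤ ∫⁻ r in Ioc ((1 / 2) ^ (k + 1) * t⁻¹) ((1 / 2) ^ k * t⁻¹),
            D ((1 / 2) ^ k * t⁻¹) * ENNReal.ofReal ((1 / 2) ^ (k + 1) * t⁻¹)⁻¹ := by
          refine setLIntegral_mono' measurableSet_Ioc fun r hr => ?_
          have hr0 : 0 < r := hpos.trans hr.1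
          refine (mul_le_of_le_one_left zero_le ?_).trans ?_
          · rw [ENNReal.ofReal_le_one, Real.exp_le_one_iff]
            have := mul_pos ht hr0
            linarith
          · gcongr
            · exact hD.monotone hr.2
            · exact hr.1.le
      _ = D ((1 / 2) ^ k * t⁻¹) := by
          rw [setLIntegral_const, Real.volume_Ioc, mul_assoc, ← ENNReal.ofReal_mul (by positivity)]
          rw [show ((1 / 2) ^ (k + 1) * t⁻¹)⁻¹ * ((1 / 2) ^ k * t⁻¹ - (1 / 2) ^ (k + 1) * t⁻¹) = 1
            by field_simp; ring]
          simp
  calc laplaceLog D t ≤ _ := lintegral_mono_set hcov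
    _ ≤ _ := lintegral_union_le _ _ _
    _ ≤ D t⁻¹ + ∑' k : ℕ, D ((1 / 2) ^ k * t⁻¹) := by
        gcongr
        exact (lintegral_iUnion_le _ _).trans (ENNReal.tsum_le_tsum h2)
    -- The tail term `D(1/t)` is the term `k = 0` of the series, whence the factor 2.
    _ ≤ _ := by
        rw [two_mul]
        gcongr
        simpa using ENNReal.le_tsum (f := fun k : ℕ => D ((1 / 2) ^ k * t⁻¹)) 0

/-- No change of variables is made: `D(c/t)^p` is dominated by an average over the block `r ∈
(c/(2t), c/t]`, and `W(c/r)` appears when Tonelli integrates the condition `t ≤ c/r` against `w`. -/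
theorem lintegral_rpow_comp_inv_le (hD : IsQuasiconcave D) {p : ℝ} (hp : 0 ≤ p) (w : ℝ → ℝ≥0)
    {c : ℝ} (hc : 0 < c) :
    ∫⁻ t, D (c * t⁻¹) ^ p ∂weightMeasure w ≤
      2 ^ (p + 1) * ∫⁻ r in Ioi (0 : ℝ),
        weightPrimitive w (c * r⁻¹) * D r ^ p * ENNReal.ofReal r⁻¹ := by
  have hDm : Measurable D := hD.monotone.measurable
  have hpt : ∀ t : ℝ, 0 < t → D (c * t⁻¹) ^ p ≤ 2 ^ (p + 1) * ∫⁻ r in Ioi (0 : ℝ),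
      (Ioc 0 (c * r⁻¹)).indicator (fun _ => D r ^ p * ENNReal.ofReal r⁻¹) t := by
    intro t ht
    have hct : 0 < c * t⁻¹ := by positivity
    have h2 : D (c * t⁻¹) ≤ 2 * D (c * t⁻¹ / 2) := by
      have := hD.le_mul (half_pos hct) (half_le_self hct.le)
      rwa [show c * t⁻¹ / (c * t⁻¹ / 2) = 2 by field_simp, ENNReal.ofReal_ofNat] at this
    -- The block has `dr/r`-mass at least 1/2; with the loss `2^p` from halving the argument this
    -- gives `2^(p+1)`.
    have hlow : D (c * t⁻¹ / 2) ^ p * 2⁻¹ ≤ ∫⁻ r in Ioi (0 : ℝ),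
        (Ioc 0 (c * r⁻¹)).indicator (fun _ => D r ^ p * ENNReal.ofReal r⁻¹) t := by
      calc D (c * t⁻¹ / 2) ^ p * 2⁻¹
          = ∫⁻ r in Ioc (c * t⁻¹ / 2) (c * t⁻¹),
              D (c * t⁻¹ / 2) ^ p * ENNReal.ofReal (c * t⁻¹)⁻¹ := by
            rw [setLIntegral_const, Real.volume_Ioc, mul_assoc,
              ← ENNReal.ofReal_mul (by positivity),
              show (c * t⁻¹)⁻¹ * (c * t⁻¹ - c * t⁻¹ / 2) = 2⁻¹ by field_simp; norm_num,
              ENNReal.ofReal_inv_of_pos two_pos, ENNReal.ofReal_ofNat]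
        _ ≤ ∫⁻ r in Ioc (c * t⁻¹ / 2) (c * t⁻¹),
              (Ioc 0 (c * r⁻¹)).indicator (fun _ => D r ^ p * ENNReal.ofReal r⁻¹) t := by
            refine setLIntegral_mono' measurableSet_Ioc fun r hr => ?_
            have hr0 : 0 < r := (half_pos hct).trans hr.1
            have hr2 := hr.2
            rw [indicator_of_mem]
            · gcongr
              · exact hD.monotone hr.1.le
            · refine ⟨ht, ?_⟩
              rw [← div_eq_mul_inv, le_div_iff₀ ht] at hr2
              rw [← div_eq_mul_inv, le_div_iff₀ hr0]
              linarith
        _ ≤ _ := lintegral_mono_set fun r hr => (half_pos hct).trans hr.1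
    calc D (c * t⁻¹) ^ p ≤ (2 * D (c * t⁻¹ / 2)) ^ p := by gcongr
      _ = 2 ^ (p + 1) * (D (c * t⁻¹ / 2) ^ p * 2⁻¹) := by
        rw [ENNReal.mul_rpow_of_nonneg _ _ hp, ENNReal.rpow_add _ _ (by simp) (by simp),
          ENNReal.rpow_one, mul_assoc, mul_left_comm 2, ENNReal.mul_inv_cancel (by simp) (by simp),
          mul_one]
      _ ≤ _ := by gcongr
  have hmeas : Measurable (Function.uncurry fun (t r : ℝ) =>
      (Ioc 0 (c * r⁻¹)).indicator (fun _ => D r ^ p * ENNReal.ofReal r⁻¹) t) := by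
    have hs : MeasurableSet {x : ℝ × ℝ | 0 < x.1 ∧ x.1 ≤ c * x.2⁻¹} :=
      (measurableSet_lt measurable_const measurable_fst).inter
        (measurableSet_le measurable_fst (by fun_prop))
    exact Measurable.indicator (f := fun x : ℝ × ℝ => D x.2 ^ p * ENNReal.ofReal x.2⁻¹)
      (by fun_prop) hs
  calc _ ≤ ∫⁻ t, 2 ^ (p + 1) * (∫⁻ r in Ioi (0 : ℝ),
        (Ioc 0 (c * r⁻¹)).indicator (fun _ => D r ^ p * ENNReal.ofReal r⁻¹) t)
          ∂weightMeasure w := by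
        refine lintegral_mono_ae ?_
        filter_upwards [ae_pos_weightMeasure w] with t ht using hpt t ht
    _ = _ := by
        rw [lintegral_const_mul _ (hmeas.lintegral_prod_right (ν := volume.restrict (Ioi 0))),
          lintegral_lintegral_swap hmeas.aemeasurable]
        congr 1
        refine lintegral_congr fun r => ?_
        rw [lintegral_indicator_const measurableSet_Ioc, weightMeasure_Ioc]
        ring

end IsQuasiconcave

/-! ### Muckenhoupt weights and reverse doubling -/

section Muckenhoupt

variable {p : ℝ} {w : ℝ → ℝ≥0}

theorem rpow_mul_rpow_neg_ae_eq_one (hw : ∀ᵐ t, 0 < w t) (y : ℝ) (s : Set ℝ) :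
    ∀ᵐ t ∂volume.restrict s, (w t : ℝ≥0∞) ^ y * (w t : ℝ≥0∞) ^ (-y) = 1 := by
  filter_upwards [ae_restrict_of_ae hw] with t ht
  rw [← ENNReal.rpow_add _ _ (by simpa using ht.ne') (by simp), add_neg_cancel, ENNReal.rpow_zero]

/-- Hölder's inequality for the pair `F w^{1/p}`, `w^{-1/p}`. -/
theorem setLIntegral_le_weighted (hp : 1 < p) (hwm : AEMeasurable w) (hw : ∀ᵐ t, 0 < w t)
    {F : ℝ → ℝ≥0∞} (hF : Measurable F) (s : Set ℝ) :
    ∫⁻ t in s, F t ≤ (∫⁻ t in s, w t * F t ^ p) ^ (1 / p) *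
      ((∫⁻ t in s, (w t : ℝ≥0∞) ^ (-(1 / (p - 1)))) ^ (p - 1)) ^ (1 / p) := by
  have hpq : p.HolderConjugate p.conjExponent := Real.HolderConjugate.conjExponent hp
  have hp0 : 0 < p := by linarith
  have hwm' : AEMeasurable w (volume.restrict s) := hwm.restrict
  have hH := ENNReal.lintegral_mul_le_Lp_mul_Lq (volume.restrict s) hpq
    (f := fun t => (w t : ℝ≥0∞) ^ (1 / p) * F t) (g := fun t => (w t : ℝ≥0∞) ^ (-(1 / p)))
    (by fun_prop) (by fun_prop)
  have hq : p.conjExponent = p / (p - 1) := rfl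
  have hp1 : p - 1 ≠ 0 := by linarith
  have hf (t : ℝ) : ((w t : ℝ≥0∞) ^ (1 / p) * F t) ^ p = w t * F t ^ p := by
    rw [ENNReal.mul_rpow_of_nonneg _ _ hp0.le, ← ENNReal.rpow_mul, one_div_mul_cancel hp0.ne',
      ENNReal.rpow_one]
  have hg (t : ℝ) : ((w t : ℝ≥0∞) ^ (-(1 / p))) ^ p.conjExponent =
      (w t : ℝ≥0∞) ^ (-(1 / (p - 1))) := by
    rw [← ENNReal.rpow_mul, hq]
    congr 1
    field_simp
  simp only [hf, hg] at hH
  rw [← ENNReal.rpow_mul, show (p - 1) * (1 / p) = 1 / p.conjExponent by rw [hq]; field_simp]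
  refine le_trans (lintegral_mono_ae ?_) hH
  filter_upwards [rpow_mul_rpow_neg_ae_eq_one hw (1 / p) s] with t ht
  rw [Pi.mul_apply, mul_right_comm, ht, one_mul]

namespace IsMuckenhoupt

theorem lintegral_mul_rpow_le (hp : 1 < p) {a b : ℝ} (hab : a < b) :
    (∫⁻ t in Icc a b, (w t : ℝ≥0∞)) *
      (∫⁻ t in Icc a b, (w t : ℝ≥0∞) ^ (-(1 / (p - 1)))) ^ (p - 1) ≤
    muckenhouptConst p w * ENNReal.ofReal (b - a) ^ p := by
  set A := ∫⁻ t in Icc a b, (w t : ℝ≥0∞)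
  set S := ∫⁻ t in Icc a b, (w t : ℝ≥0∞) ^ (-(1 / (p - 1)))
  set L := ENNReal.ofReal (b - a) with hL
  have hL0 : L ≠ 0 := by simp [hL, hab]
  have hLt : L ≠ ∞ := by simp [hL]
  have hle : (L⁻¹ * A) * (L⁻¹ * S) ^ (p - 1) ≤ muckenhouptConst p w :=
    le_iSup_of_le a (le_iSup_of_le b (le_iSup_of_le hab le_rfl))
  have : (L⁻¹ * A) * (L⁻¹ * S) ^ (p - 1) = (A * S ^ (p - 1)) / L ^ p := by
    rw [ENNReal.mul_rpow_of_nonneg _ _ (by linarith), div_eq_mul_inv, ← ENNReal.inv_rpow]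
    have : L⁻¹ ^ p = L⁻¹ * L⁻¹ ^ (p - 1) := by
      nth_rw 2 [← ENNReal.rpow_one L⁻¹]
      rw [← ENNReal.rpow_add _ _ (by simp [hLt]) (by simp [hL0])]
      congr 1; ring
    rw [this]
    ring
  rw [this] at hle
  rwa [ENNReal.div_le_iff_le_mul] at hle
  · exact Or.inl (by simp [hL0, hLt])
  · exact Or.inl (by simp [hL0, hLt])

theorem lintegral_Icc_ne_zero (hw : IsMuckenhoupt p w) {a b : ℝ} (hab : a < b) :
    ∫⁻ t in Icc a b, (w t : ℝ≥0∞) ≠ 0 := by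
  intro h
  have hwm : AEMeasurable w (volume.restrict (Icc a b)) := hw.aemeasurable.restrict
  rw [lintegral_eq_zero_iff' (by fun_prop)] at h
  have h0 : ∀ᵐ t ∂volume.restrict (Icc a b), False := by
    filter_upwards [h, ae_restrict_of_ae hw.ae_pos] with t h1 h2
    simp only [Pi.zero_apply, ENNReal.coe_eq_zero] at h1
    exact h2.ne' h1
  rw [Filter.eventually_false_iff_eq_bot, ae_eq_bot, Measure.restrict_eq_zero,
    Real.volume_Icc, ENNReal.ofReal_eq_zero] at h0
  linarith

/-- The other factor in the `A_p` product is nonzero, so an infinite dual integral would make the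
product infinite. -/
theorem lintegral_rpow_Icc_ne_top (hp : 1 < p) (hw : IsMuckenhoupt p w) {a b : ℝ} (hab : a < b) :
    ∫⁻ t in Icc a b, (w t : ℝ≥0∞) ^ (-(1 / (p - 1))) ≠ ∞ := by
  intro h
  have hle := lintegral_mul_rpow_le (w := w) hp hab
  rw [h, ENNReal.top_rpow_of_pos (by linarith), ENNReal.mul_top (hw.lintegral_Icc_ne_zero hab),
    top_le_iff] at hle
  exact ENNReal.mul_ne_top hw.const_lt_top.ne
    (ENNReal.rpow_ne_top_of_nonneg (by linarith) ENNReal.ofReal_ne_top) hle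

/-- The mass of an interval is controlled by the mass of its right half. -/
theorem weightPrimitive_two_mul_le (hp : 1 < p) (hw : IsMuckenhoupt p w) {s : ℝ} (hs : 0 < s) :
    weightPrimitive w (2 * s) ≤ muckenhouptConst p w * 2 ^ p * ∫⁻ t in Ioc s (2 * s), w t := by
  have hp0 : 0 < p := by linarith
  have h2s : (0 : ℝ) < 2 * s := by linarith
  set A := ∫⁻ t in Icc 0 (2 * s), (w t : ℝ≥0∞)
  set E := ∫⁻ t in Ioc s (2 * s), (w t : ℝ≥0∞)
  set S := ∫⁻ t in Icc 0 (2 * s), (w t : ℝ≥0∞) ^ (-(1 / (p - 1)))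
  set q := muckenhouptConst p w
  have hWA : weightPrimitive w (2 * s) ≤ A := lintegral_mono_set Ioc_subset_Icc_self
  -- Hölder for the constant function 1 on the right half; the dual integral is then enlarged to the
  -- whole interval so that it matches the one in the `A_p` bound.
  have hE : ENNReal.ofReal s ^ p ≤ E * S ^ (p - 1) := by
    have hH := setLIntegral_le_weighted hp hw.aemeasurable hw.ae_pos
      (measurable_const (a := (1 : ℝ≥0∞))) (Ioc s (2 * s))
    simp only [ENNReal.one_rpow, mul_one, setLIntegral_one, Real.volume_Ioc] at hH
    rw [← ENNReal.mul_rpow_of_nonneg _ _ (by positivity), one_div p,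
      ENNReal.le_rpow_inv_iff hp0] at hH
    rw [show 2 * s - s = s by ring] at hH
    refine hH.trans ?_
    have : 0 ≤ p - 1 := by linarith
    gcongr
    exact lintegral_mono_set fun x hx => ⟨hs.le.trans hx.1.le, hx.2⟩
  have hA : A * S ^ (p - 1) ≤ q * (2 ^ p * ENNReal.ofReal s ^ p) := by
    have := lintegral_mul_rpow_le (w := w) hp h2s
    rwa [sub_zero, ENNReal.ofReal_mul zero_le_two, ENNReal.ofReal_ofNat,
      ENNReal.mul_rpow_of_nonneg _ _ hp0.le] at this
  have hsp0 : ENNReal.ofReal s ^ p ≠ 0 := by simp [hs]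
  have hspt : ENNReal.ofReal s ^ p ≠ ∞ :=
    ENNReal.rpow_ne_top_of_nonneg hp0.le ENNReal.ofReal_ne_top
  -- Multiplying by `s^p`, which is positive and finite, avoids dividing by the dual integral.
  refine hWA.trans ?_
  rw [← ENNReal.mul_le_mul_iff_left hsp0 hspt]
  calc A * ENNReal.ofReal s ^ p ≤ A * (E * S ^ (p - 1)) := by gcongr
    _ = A * S ^ (p - 1) * E := by ring
    _ ≤ q * (2 ^ p * ENNReal.ofReal s ^ p) * E := by gcongr
    _ = _ := by ring

end IsMuckenhoupt

/-- The ratio in the reverse doubling inequality for a weight with `A_p` constant `q`. -/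
def reverseDoublingRatio (p : ℝ) (q : ℝ≥0∞) : ℝ≥0∞ := (1 + (q * 2 ^ p + 1)⁻¹)⁻¹

theorem reverseDoublingRatio_lt_one (hp : 1 < p) {q : ℝ≥0∞} (hq : q ≠ ∞) :
    reverseDoublingRatio p q < 1 := by
  rw [reverseDoublingRatio, ENNReal.inv_lt_one]
  refine ENNReal.lt_add_right ENNReal.one_ne_top ?_
  rw [ne_eq, ENNReal.inv_eq_zero]
  exact ENNReal.add_ne_top.2 ⟨ENNReal.mul_ne_top hq
    (ENNReal.rpow_ne_top_of_nonneg (by linarith) (by simp)), ENNReal.one_ne_top⟩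

namespace IsMuckenhoupt

/-- With `E` the mass of the right half and `c = q 2^p + 1`, one has `W(s) ≤ W(2s) ≤ c E`, hence
`W(2s) = W(s) + E ≥ (1 + 1/c) W(s)`. The summand 1 in `c` only keeps it nonzero. -/
theorem weightPrimitive_le_two_mul (hp : 1 < p) (hw : IsMuckenhoupt p w) {s : ℝ} (hs : 0 < s) :
    weightPrimitive w s ≤
      reverseDoublingRatio p (muckenhouptConst p w) * weightPrimitive w (2 * s) := by
  set q := muckenhouptConst p w
  have hE := weightPrimitive_two_mul_le hp hw hs
  set E := ∫⁻ t in Ioc s (2 * s), (w t : ℝ≥0∞)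
  have hsplit : weightPrimitive w (2 * s) = weightPrimitive w s + E := by
    rw [weightPrimitive, ← Ioc_union_Ioc_eq_Ioc hs.le (by linarith : s ≤ 2 * s),
      lintegral_union measurableSet_Ioc]
    · rfl
    · exact Ioc_disjoint_Ioc_of_le le_rfl
  have hc : (q * 2 ^ p + 1)⁻¹ ≠ ∞ := by simp
  have hmono : weightPrimitive w s ≤ weightPrimitive w (2 * s) := by rw [hsplit]; exact le_self_add
  rw [reverseDoublingRatio, mul_comm, ← div_eq_mul_inv, ENNReal.le_div_iff_mul_le
    (Or.inl (by simp)) (Or.inl (ENNReal.add_ne_top.2 ⟨ENNReal.one_ne_top, hc⟩)), mul_add, mul_one]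
  conv_rhs => rw [hsplit]
  gcongr
  rw [← div_eq_mul_inv]
  refine ENNReal.div_le_of_le_mul' (hmono.trans (hE.trans ?_))
  gcongr
  exact le_self_add

theorem weightPrimitive_half_pow_mul_le (hp : 1 < p) (hw : IsMuckenhoupt p w) (k : ℕ) {s : ℝ}
    (hs : 0 < s) :
    weightPrimitive w ((1 / 2) ^ k * s) ≤
      reverseDoublingRatio p (muckenhouptConst p w) ^ k * weightPrimitive w s := by
  induction k with
  | zero => simp
  | succ k ih =>
    have := hw.weightPrimitive_le_two_mul hp (s := (1 / 2) ^ (k + 1) * s) (by positivity)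
    rw [show 2 * ((1 / 2) ^ (k + 1) * s) = (1 / 2) ^ k * s by ring] at this
    refine this.trans ?_
    rw [pow_succ', mul_assoc]
    gcongr

end IsMuckenhoupt

/-! ### Weighted bounds and local integrability of the Laplace transform -/

/-- The norm bound of the Laplace transform on quasiconcave functions. -/
def laplaceConst (p : ℝ) (q : ℝ≥0∞) : ℝ≥0∞ :=
  2 * (2 ^ (p + 1)) ^ (1 / p) * (1 - reverseDoublingRatio p q ^ (1 / p))⁻¹

theorem laplaceConst_ne_top (hp : 1 < p) {q : ℝ≥0∞} (hq : q ≠ ∞) : laplaceConst p q ≠ ∞ := by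
  refine ENNReal.mul_ne_top (ENNReal.mul_ne_top (by simp) ?_) ?_
  · exact ENNReal.rpow_ne_top_of_nonneg (by positivity)
      (ENNReal.rpow_ne_top_of_nonneg (by linarith) (by simp))
  · rw [ENNReal.inv_ne_top]
    exact (tsub_pos_of_lt (ENNReal.rpow_lt_one (reverseDoublingRatio_lt_one hp hq)
      (by positivity))).ne'

theorem interpFunctional_weightPrimitive (hp : 1 < p) (w : ℝ → ℝ≥0) (D : ℝ → ℝ≥0∞) :
    interpFunctional (fun t => weightPrimitive w t ^ (1 / p)) p D =
      (∫⁻ r in Ioi (0 : ℝ), weightPrimitive w r⁻¹ * D r ^ p * ENNReal.ofReal r⁻¹) ^ (1 / p) := by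
  have hp0 : 0 < p := by linarith
  simp only [interpFunctional]
  congr 2 with r
  rw [ENNReal.mul_rpow_of_nonneg _ _ hp0.le, ← ENNReal.rpow_mul, one_div_mul_cancel hp0.ne',
    ENNReal.rpow_one]

namespace IsQuasiconcave

variable {D : ℝ → ℝ≥0∞}

/-- Minkowski is applied to the dyadic series; reverse doubling at `s = 1/r` makes the norm of its
`k`-th term at most a constant times `θ^{k/p}`. -/
theorem lintegral_laplaceLog_rpow_le (hD : IsQuasiconcave D) (hp : 1 < p)
    (hw : IsMuckenhoupt p w) :
    (∫⁻ t, laplaceLog D t ^ p ∂weightMeasure w) ^ (1 / p) ≤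
      laplaceConst p (muckenhouptConst p w) *
        interpFunctional (fun t => weightPrimitive w t ^ (1 / p)) p D := by
  have hp0 : 0 < p := by linarith
  have hDm : Measurable D := hD.monotone.measurable
  rw [interpFunctional_weightPrimitive hp]
  set M := ∫⁻ r in Ioi (0 : ℝ), weightPrimitive w r⁻¹ * D r ^ p * ENNReal.ofReal r⁻¹
  set θ := reverseDoublingRatio p (muckenhouptConst p w)
  have hk (k : ℕ) : (∫⁻ t, (2 * D ((1 / 2) ^ k * t⁻¹)) ^ p ∂weightMeasure w) ^ (1 / p) ≤
      2 * (2 ^ (p + 1)) ^ (1 / p) * M ^ (1 / p) * (θ ^ (1 / p)) ^ k := by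
    have h1 : ∫⁻ t, D ((1 / 2) ^ k * t⁻¹) ^ p ∂weightMeasure w ≤ 2 ^ (p + 1) * (θ ^ k * M) := by
      refine (hD.lintegral_rpow_comp_inv_le hp0.le w (c := (1 / 2) ^ k) (by positivity)).trans ?_
      gcongr
      rw [← lintegral_const_mul' _ _ (ENNReal.pow_ne_top
        (reverseDoublingRatio_lt_one hp hw.const_lt_top.ne).ne_top)]
      refine setLIntegral_mono' measurableSet_Ioi fun r hr => ?_
      rw [mul_assoc, mul_assoc, ← mul_assoc (θ ^ k)]
      gcongr
      exact hw.weightPrimitive_half_pow_mul_le hp k (inv_pos.2 hr)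
    have h2 : ∫⁻ t, (2 * D ((1 / 2) ^ k * t⁻¹)) ^ p ∂weightMeasure w =
        2 ^ p * ∫⁻ t, D ((1 / 2) ^ k * t⁻¹) ^ p ∂weightMeasure w := by
      rw [← lintegral_const_mul _ (by fun_prop)]
      simp_rw [ENNReal.mul_rpow_of_nonneg _ _ hp0.le]
    have hi : 0 ≤ 1 / p := by positivity
    rw [h2]
    calc _ ≤ (2 ^ p * (2 ^ (p + 1) * (θ ^ k * M))) ^ (1 / p) := by gcongr
      _ = _ := by
        rw [ENNReal.mul_rpow_of_nonneg _ _ hi, ENNReal.mul_rpow_of_nonneg _ _ hi,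
          ENNReal.mul_rpow_of_nonneg _ _ hi, ← ENNReal.rpow_mul 2 p, mul_one_div_cancel hp0.ne',
          ENNReal.rpow_one, ← ENNReal.rpow_natCast θ k, ← ENNReal.rpow_natCast (θ ^ (1 / p)) k,
          ← ENNReal.rpow_mul θ, ← ENNReal.rpow_mul θ, mul_comm (k : ℝ)]
        ring
  calc _ ≤ (∫⁻ t, (∑' k : ℕ, 2 * D ((1 / 2) ^ k * t⁻¹)) ^ p ∂weightMeasure w) ^ (1 / p) := by
        have hi : 0 ≤ 1 / p := by positivity
        refine ENNReal.rpow_le_rpow (lintegral_mono_ae ?_) hi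
        filter_upwards [ae_pos_weightMeasure w] with t ht
        rw [ENNReal.tsum_mul_left]
        gcongr
        exact hD.laplaceLog_le ht
    _ ≤ ∑' k : ℕ, (∫⁻ t, (2 * D ((1 / 2) ^ k * t⁻¹)) ^ p ∂weightMeasure w) ^ (1 / p) :=
        ENNReal.lintegral_Lp_tsum_le hp.le fun k => by fun_prop
    _ ≤ ∑' k : ℕ, 2 * (2 ^ (p + 1)) ^ (1 / p) * M ^ (1 / p) * (θ ^ (1 / p)) ^ k :=
        ENNReal.tsum_le_tsum hk
    _ = _ := by
        rw [ENNReal.tsum_mul_left, ENNReal.tsum_geometric, laplaceConst]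
        ring

theorem setLIntegral_laplaceLog_ne_top (hD : IsQuasiconcave D) (hp : 1 < p)
    (hw : IsMuckenhoupt p w)
    (hfin : interpFunctional (fun t => weightPrimitive w t ^ (1 / p)) p D ≠ ∞) {T : ℝ}
    (hT : 0 < T) : ∫⁻ t in Ioc 0 T, laplaceLog D t ≠ ∞ := by
  have hp0 : 0 < p := by linarith
  have hBm : Measurable (laplaceLog D) := (antitone_laplaceLog D).measurable
  refine ne_top_of_le_ne_top ?_
    (setLIntegral_le_weighted hp hw.aemeasurable hw.ae_pos hBm (Ioc 0 T))
  have h1 := ne_top_of_le_ne_top (ENNReal.mul_ne_top (laplaceConst_ne_top hp hw.const_lt_top.ne)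
    hfin) (hD.lintegral_laplaceLog_rpow_le hp hw)
  rw [weightMeasure, lintegral_withDensity_eq_lintegral_mul₀
    hw.aemeasurable.restrict.coe_nnreal_ennreal (by fun_prop)] at h1
  refine ENNReal.mul_ne_top (ne_top_of_le_ne_top h1 ?_) ?_
  · exact ENNReal.rpow_le_rpow (lintegral_mono_set Ioc_subset_Ioi_self) (by positivity)
  · refine ENNReal.rpow_ne_top_of_nonneg (by positivity)
      (ENNReal.rpow_ne_top_of_nonneg (by linarith) ?_)
    exact ne_top_of_le_ne_top (hw.lintegral_rpow_Icc_ne_top hp hT)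
      (lintegral_mono_set Ioc_subset_Icc_self)

end IsQuasiconcave

/-- The transform is nonincreasing, so an infinite value at `t` would persist on all of `(0,t]`. -/
theorem laplaceLog_ne_top_of_setLIntegral {D : ℝ → ℝ≥0∞} {t : ℝ} (ht : 0 < t)
    (h : ∫⁻ s in Ioc 0 t, laplaceLog D s ≠ ∞) : laplaceLog D t ≠ ∞ := by
  have hle : laplaceLog D t * ENNReal.ofReal t ≤ ∫⁻ s in Ioc 0 t, laplaceLog D s := by
    calc _ = ∫⁻ s in Ioc 0 t, laplaceLog D t := by rw [setLIntegral_const, Real.volume_Ioc, sub_zero]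
      _ ≤ _ := setLIntegral_mono' measurableSet_Ioc fun s hs => antitone_laplaceLog D hs.2
  intro htop
  rw [htop, ENNReal.top_mul (by simpa using ht), top_le_iff] at hle
  exact h hle

/-- By Tonelli, since `∫₀¹ e^{-sr} ds ≥ e^{-1} min(1, 1/r)`. For `D = K(·, a)` the conclusion is the
integrability condition under which the fundamental lemma applies. -/
theorem lintegral_min_mul_ne_top {D : ℝ → ℝ≥0∞} (hD : Measurable D)
    (h : ∫⁻ s in Ioc 0 1, laplaceLog D s ≠ ∞) :
    ∫⁻ r in Ioi (0 : ℝ), ENNReal.ofReal (min 1 r⁻¹) * (D r * ENNReal.ofReal r⁻¹) ≠ ∞ := by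
  have hle : ENNReal.ofReal (Real.exp (-1)) *
      ∫⁻ r in Ioi (0 : ℝ), ENNReal.ofReal (min 1 r⁻¹) * (D r * ENNReal.ofReal r⁻¹) ≤
        ∫⁻ s in Ioc 0 1, laplaceLog D s := by
    have hswap : ∫⁻ s in Ioc 0 1, laplaceLog D s = ∫⁻ r in Ioi (0 : ℝ), ∫⁻ s in Ioc (0 : ℝ) 1,
        ENNReal.ofReal (Real.exp (-(s * r))) * (D r * ENNReal.ofReal r⁻¹) :=
      lintegral_lintegral_swap (by fun_prop)
    rw [hswap, ← lintegral_const_mul _ (by fun_prop)]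
    refine setLIntegral_mono' measurableSet_Ioi fun r hr => ?_
    have hr : 0 < r := hr
    have hm : 0 < min 1 r⁻¹ := by positivity
    rw [lintegral_mul_const _ (by fun_prop), ← mul_assoc]
    gcongr
    calc _ = ∫⁻ s in Ioc 0 (min 1 r⁻¹), ENNReal.ofReal (Real.exp (-1)) := by
          rw [setLIntegral_const, Real.volume_Ioc, sub_zero]
      _ ≤ ∫⁻ s in Ioc 0 (min 1 r⁻¹), ENNReal.ofReal (Real.exp (-(s * r))) := by
          refine setLIntegral_mono' measurableSet_Ioc fun s hs => ?_
          gcongr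
          have := hs.2.trans (min_le_right _ _)
          rwa [← one_div, le_div_iff₀ hr] at this
      _ ≤ _ := lintegral_mono_set (Ioc_subset_Ioc_right (min_le_left _ _))
  intro htop
  rw [htop, ENNReal.mul_top (by simp [Real.exp_pos]), top_le_iff] at hle
  exact h hle

end Muckenhoupt

/-! ### Dyadic decomposition of the half-line -/

theorem floor_logb_two_eq_iff {r : ℝ} (hr : 0 < r) (n : ℤ) :
    ⌊Real.logb 2 r⌋ = n ↔ r ∈ Ico ((2 : ℝ) ^ n) (2 ^ (n + 1)) := by
  rw [Int.floor_eq_iff, Real.le_logb_iff_rpow_le one_lt_two hr, ← Int.cast_one, ← Int.cast_add,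
    Real.logb_lt_iff_lt_rpow one_lt_two hr, Real.rpow_intCast, Real.rpow_intCast, mem_Ico]

theorem iUnion_Ico_two_zpow : ⋃ n : ℤ, Ico ((2 : ℝ) ^ n) (2 ^ (n + 1)) = Ioi 0 := by
  ext r
  simp only [mem_iUnion, mem_Ioi]
  exact ⟨fun ⟨n, hn⟩ => (by positivity : (0 : ℝ) < 2 ^ n).trans_le hn.1,
    fun hr => ⟨_, (floor_logb_two_eq_iff hr _).1 rfl⟩⟩

theorem pairwise_disjoint_Ico_two_zpow :
    Pairwise (Function.onFun Disjoint fun n : ℤ => Ico ((2 : ℝ) ^ n) (2 ^ (n + 1))) := by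
  intro m n hmn
  refine Set.disjoint_left.2 fun r hm hn => hmn ?_
  have hr : 0 < r := (by positivity : (0 : ℝ) < 2 ^ m).trans_le hm.1
  rw [← (floor_logb_two_eq_iff hr m).2 hm, (floor_logb_two_eq_iff hr n).2 hn]

theorem setIntegral_inv_Ico_two_zpow (n : ℤ) :
    ∫ r in Ico ((2 : ℝ) ^ n) (2 ^ (n + 1)), r⁻¹ = Real.log 2 := by
  have hn : (0 : ℝ) < 2 ^ n := by positivity
  have hle : (2 : ℝ) ^ n ≤ 2 ^ (n + 1) := zpow_le_zpow_right₀ one_le_two (by omega)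
  rw [integral_Ico_eq_integral_Ioo, ← integral_Ioc_eq_integral_Ioo,
    ← intervalIntegral.integral_of_le hle, integral_inv_of_pos hn (hn.trans_le hle),
    zpow_add_one₀ two_ne_zero, mul_div_cancel_left₀ _ hn.ne']

/-- A quasiconcave function is small along dyadic points at `0` and, relative to `r`, at `∞`. -/
theorem IsQuasiconcave.tendsto_two_zpow {D : ℝ → ℝ≥0∞} (hD : IsQuasiconcave D)
    (h : ∫⁻ r in Ioi (0 : ℝ), ENNReal.ofReal (min 1 r⁻¹) * (D r * ENNReal.ofReal r⁻¹) ≠ ∞) :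
    Filter.Tendsto (fun n : ℤ => ENNReal.ofReal (min 1 ((2 : ℝ) ^ n)⁻¹) * D (2 ^ n))
      Filter.cofinite (nhds 0) := by
  refine ENNReal.tendsto_cofinite_zero_of_tsum_ne_top ?_
  rw [← iUnion_Ico_two_zpow, lintegral_iUnion (fun _ => measurableSet_Ico)
    pairwise_disjoint_Ico_two_zpow] at h
  -- The 4 is two factors of 2: `min(1, 1/r)` may halve across a dyadic block, and the lower bound
  -- used for its `dr/r`-mass is 1/2.
  refine ne_top_of_le_ne_top (ENNReal.mul_ne_top (ENNReal.ofNat_ne_top (n := 4)) h) ?_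
  rw [← ENNReal.tsum_mul_left]
  refine ENNReal.tsum_le_tsum fun n => ?_
  have hn : (0 : ℝ) < 2 ^ n := by positivity
  have hn1 : (2 : ℝ) ^ (n + 1) = 2 * 2 ^ n := by rw [zpow_add_one₀ two_ne_zero, mul_comm]
  have hm : 0 < min 1 ((2 : ℝ) ^ n)⁻¹ := by positivity
  rw [hn1]
  calc _ = 4 * (ENNReal.ofReal (2⁻¹ * min 1 ((2 : ℝ) ^ n)⁻¹) *
        (D (2 ^ n) * ENNReal.ofReal (2 * 2 ^ n)⁻¹) * ENNReal.ofReal (2 * 2 ^ n - 2 ^ n)) := by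
        have : ENNReal.ofReal (2 * 2 ^ n)⁻¹ * ENNReal.ofReal (2 * 2 ^ n - 2 ^ n) =
            ENNReal.ofReal 2⁻¹ := by
          rw [← ENNReal.ofReal_mul (by positivity)]; congr 1; field_simp; ring
        have h4 : (4 : ℝ≥0∞) * (ENNReal.ofReal 2⁻¹ * ENNReal.ofReal 2⁻¹) = 1 := by
          rw [← ENNReal.ofReal_ofNat 4, ← ENNReal.ofReal_mul (by norm_num),
            ← ENNReal.ofReal_mul (by norm_num)]
          norm_num
        rw [mul_assoc, mul_assoc, this, ENNReal.ofReal_mul (by positivity)]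
        calc _ = (4 * (ENNReal.ofReal 2⁻¹ * ENNReal.ofReal 2⁻¹)) *
              (ENNReal.ofReal (min 1 ((2 : ℝ) ^ n)⁻¹) * D (2 ^ n)) := by rw [h4, one_mul]
          _ = _ := by ring
    _ = 4 * ∫⁻ r in Ico ((2 : ℝ) ^ n) (2 * 2 ^ n), ENNReal.ofReal (2⁻¹ * min 1 ((2 : ℝ) ^ n)⁻¹) *
        (D (2 ^ n) * ENNReal.ofReal (2 * 2 ^ n)⁻¹) := by
        rw [setLIntegral_const, Real.volume_Ico]
    _ ≤ _ := by
        gcongr 4 * ?_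
        refine setLIntegral_mono' measurableSet_Ico fun r hr => ?_
        have hr0 : 0 < r := hn.trans_le hr.1
        gcongr
        · refine le_min ?_ ?_
          · have := min_le_left (1 : ℝ) ((2 : ℝ) ^ n)⁻¹
            linarith
          · calc _ ≤ 2⁻¹ * ((2 : ℝ) ^ n)⁻¹ := by gcongr; exact min_le_right _ _
              _ = (2 * 2 ^ n)⁻¹ := by rw [mul_inv]
              _ ≤ r⁻¹ := by gcongr; exact hr.2.le
        · exact hD.monotone hr.1
        · exact hr.2.le

/-! ### The `K`-functional and the fundamental lemma -/

namespace InterpolationCouple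

variable {X₀ X₁ Z : Type*}
  [NormedAddCommGroup X₀] [NormedSpace ℝ X₀] [NormedAddCommGroup X₁] [NormedSpace ℝ X₁]
  [AddCommGroup Z] [Module ℝ Z] [TopologicalSpace Z] [IsTopologicalAddGroup Z]

theorem ofInter_eq_inl (C : InterpolationCouple X₀ X₁ Z) (x : C.interSpace) :
    C.ofInter x = C.inl (x : X₀ × X₁).1 := rfl

theorem exists_eq_inl_add_inr (C : InterpolationCouple X₀ X₁ Z) (a : C.SumSpace) :
    ∃ x₀ x₁, a = C.inl x₀ + C.inr x₁ := by
  obtain ⟨x, rfl⟩ := Submodule.Quotient.mk_surjective _ a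
  exact ⟨_, _, C.mk_eq_inl_add_inr x⟩

theorem K_le (C : InterpolationCouple X₀ X₁ Z) {a : C.SumSpace} {x₀ : X₀} {x₁ : X₁}
    (h : a = C.inl x₀ + C.inr x₁) (t : ℝ) : C.K t a ≤ ‖x₀‖ₑ + ENNReal.ofReal t * ‖x₁‖ₑ :=
  iInf_le_of_le x₀ (iInf_le_of_le x₁ (iInf_le_of_le h le_rfl))

theorem K_ne_top (C : InterpolationCouple X₀ X₁ Z) (t : ℝ) (a : C.SumSpace) : C.K t a ≠ ∞ := by
  obtain ⟨x₀, x₁, h⟩ := C.exists_eq_inl_add_inr a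
  refine ne_top_of_le_ne_top ?_ (C.K_le h t)
  finiteness

/-- Each competitor `‖x₀‖ + t ‖x₁‖` is nondecreasing in `t`, its quotient by `t` is nonincreasing,
and both properties pass to the infimum. -/
theorem isQuasiconcave_K (C : InterpolationCouple X₀ X₁ Z) (a : C.SumSpace) :
    IsQuasiconcave fun t => C.K t a where
  monotone s t hst := by
    refine le_iInf fun x₀ => le_iInf fun x₁ => le_iInf fun h => (C.K_le h s).trans ?_
    gcongr
  le_mul s t hs hst := by
    have ht : 0 < t := hs.trans_le hst
    have h1 : ENNReal.ofReal (s / t) * C.K t a ≤ C.K s a := by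
      refine le_iInf fun x₀ => le_iInf fun x₁ => le_iInf fun h => ?_
      calc _ ≤ ENNReal.ofReal (s / t) * (‖x₀‖ₑ + ENNReal.ofReal t * ‖x₁‖ₑ) := by
            gcongr; exact C.K_le h t
        _ ≤ _ := by
            rw [mul_add, ← mul_assoc, ← ENNReal.ofReal_mul (by positivity),
              div_mul_cancel₀ _ ht.ne']
            gcongr
            refine mul_le_of_le_one_left zero_le ?_
            rw [ENNReal.ofReal_le_one]
            exact div_le_one_of_le₀ hst ht.le
    calc C.K t a = ENNReal.ofReal (t / s) * (ENNReal.ofReal (s / t) * C.K t a) := by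
          rw [← mul_assoc, ← ENNReal.ofReal_mul (by positivity),
            show t / s * (s / t) = 1 by field_simp, ENNReal.ofReal_one, one_mul]
      _ ≤ _ := by gcongr

section Topology

variable [T2Space Z]

theorem norm_inl_le (C : InterpolationCouple X₀ X₁ Z) (x : X₀) : ‖C.inl x‖ ≤ ‖x‖ := by
  rw [norm_eq_sInf]
  refine csInf_le ⟨0, ?_⟩ ⟨x, 0, by simp, by simp⟩
  rintro r ⟨x₀, x₁, -, rfl⟩
  positivity

theorem norm_inr_le (C : InterpolationCouple X₀ X₁ Z) (x : X₁) : ‖C.inr x‖ ≤ ‖x‖ := by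
  rw [norm_eq_sInf]
  refine csInf_le ⟨0, ?_⟩ ⟨0, x, by simp, by simp⟩
  rintro r ⟨x₀, x₁, -, rfl⟩
  positivity

/-- The embedding `X₀ ⊆ X₀ + X₁` as a bounded operator. -/
def inlL (C : InterpolationCouple X₀ X₁ Z) : X₀ →L[ℝ] C.SumSpace :=
  C.inl.mkContinuous 1 fun x => by simpa using C.norm_inl_le x

/-- The embedding `X₁ ⊆ X₀ + X₁` as a bounded operator. -/
def inrL (C : InterpolationCouple X₀ X₁ Z) : X₁ →L[ℝ] C.SumSpace :=
  C.inr.mkContinuous 1 fun x => by simpa using C.norm_inr_le x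

@[simp] theorem inlL_apply (C : InterpolationCouple X₀ X₁ Z) (x : X₀) : C.inlL x = C.inl x := rfl

@[simp] theorem inrL_apply (C : InterpolationCouple X₀ X₁ Z) (x : X₁) : C.inrL x = C.inr x := rfl

theorem enorm_inl_le (C : InterpolationCouple X₀ X₁ Z) (x : X₀) : ‖C.inl x‖ₑ ≤ ‖x‖ₑ :=
  enorm_le_iff_norm_le.2 (C.norm_inl_le x)

theorem enorm_inr_le (C : InterpolationCouple X₀ X₁ Z) (x : X₁) : ‖C.inr x‖ₑ ≤ ‖x‖ₑ :=
  enorm_le_iff_norm_le.2 (C.norm_inr_le x)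

theorem continuous_ofInter (C : InterpolationCouple X₀ X₁ Z) : Continuous C.ofInter :=
  C.inlL.continuous.comp (continuous_fst.comp continuous_subtype_val)

theorem enorm_ofInter_le (C : InterpolationCouple X₀ X₁ Z) {r : ℝ} (hr : 0 < r)
    (x : C.interSpace) : ‖C.ofInter x‖ₑ ≤ ENNReal.ofReal (min 1 r⁻¹) * C.J r x := by
  have h0 : ‖C.ofInter x‖ₑ ≤ C.J r x := (C.enorm_inl_le _).trans (le_max_left _ _)
  have h1 : ‖C.ofInter x‖ₑ ≤ ENNReal.ofReal r⁻¹ * C.J r x := by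
    rw [ofInter_eq_inr]
    refine (C.enorm_inr_le _).trans ?_
    calc ‖(x : X₀ × X₁).2‖ₑ = ENNReal.ofReal r⁻¹ * (ENNReal.ofReal r * ‖(x : X₀ × X₁).2‖ₑ) := by
          rw [← mul_assoc, ← ENNReal.ofReal_mul (by positivity), inv_mul_cancel₀ hr.ne',
            ENNReal.ofReal_one, one_mul]
      _ ≤ _ := by gcongr; exact le_max_right _ _
  rcases min_cases (1 : ℝ) r⁻¹ with ⟨h, -⟩ | ⟨h, -⟩ <;> rw [h]
  · simpa using h0
  · exact h1

theorem eq_zero_of_K_eq_zero (C : InterpolationCouple X₀ X₁ Z) {t : ℝ} (ht : 0 < t)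
    {a : C.SumSpace} (h : C.K t a = 0) : a = 0 := by
  have hle : ENNReal.ofReal (min 1 t) * ‖a‖ₑ ≤ C.K t a := by
    refine le_iInf fun x₀ => le_iInf fun x₁ => le_iInf fun h => ?_
    calc _ ≤ ENNReal.ofReal (min 1 t) * (‖x₀‖ₑ + ‖x₁‖ₑ) := by
          gcongr
          rw [h]
          have hadd := enorm_add_le (C.inl x₀) (C.inr x₁)
          exact hadd.trans (add_le_add (C.enorm_inl_le _) (C.enorm_inr_le _))
      _ ≤ _ := by
          rw [mul_add]
          gcongr
          · refine mul_le_of_le_one_left zero_le ?_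
            rw [ENNReal.ofReal_le_one]
            exact min_le_left _ _
          · exact min_le_right _ _
  rw [h, nonpos_iff_eq_zero, mul_eq_zero] at hle
  have h0 : ‖a‖ₑ = 0 := hle.resolve_left (by simp [ht])
  simpa [enorm_eq_nnnorm] using h0

/-- The factor 2 leaves room below the infimum unless `K(t, a) = 0`; in that case `a = 0`, because
`K(t, a) ≥ min(1, t) ‖a‖`. -/
theorem exists_decomposition (C : InterpolationCouple X₀ X₁ Z) {t : ℝ} (ht : 0 < t)
    (a : C.SumSpace) : ∃ x₀ x₁, a = C.inl x₀ + C.inr x₁ ∧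
      ‖x₀‖ₑ + ENNReal.ofReal t * ‖x₁‖ₑ ≤ 2 * C.K t a := by
  by_cases h : C.K t a = 0
  · exact ⟨0, 0, by simpa using C.eq_zero_of_K_eq_zero ht h, by simp⟩
  · have hlt : C.K t a < 2 * C.K t a := by
      rw [two_mul]; exact ENNReal.lt_add_right (C.K_ne_top t a) h
    conv_lhs at hlt => rw [K]
    simp only [iInf_lt_iff] at hlt
    obtain ⟨x₀, x₁, h, hx⟩ := hlt
    exact ⟨x₀, x₁, h, hx.le⟩

/-- The fundamental lemma of interpolation theory, with integrals instead of sums. -/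
theorem exists_isJRepresentation [CompleteSpace X₀] [CompleteSpace X₁]
    (C : InterpolationCouple X₀ X₁ Z) (a : C.SumSpace)
    (hfin : ∫⁻ r in Ioi (0 : ℝ),
      ENNReal.ofReal (min 1 r⁻¹) * (C.K r a * ENNReal.ofReal r⁻¹) ≠ ∞) :
    ∃ v : ℝ → C.interSpace, StronglyMeasurable v ∧ C.IsJRepresentation v a ∧
      ∀ r, 0 < r → C.J r (v r) ≤ 16 * C.K r a := by
  have hpos (n : ℤ) : (0 : ℝ) < 2 ^ n := by positivity
  have hsucc (n : ℤ) : (2 : ℝ) ^ (n + 1) = 2 * 2 ^ n := by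
    rw [zpow_add_one₀ two_ne_zero, mul_comm]
  have hK := C.isQuasiconcave_K a
  choose x₀ x₁ hx hle using fun n : ℤ => C.exists_decomposition (hpos n) a
  have hK2 (n : ℤ) : C.K (2 ^ (n + 1)) a ≤ 2 * C.K (2 ^ n) a := by
    have := hK.le_mul (hpos n) (by rw [hsucc]; linarith [hpos n] : (2 : ℝ) ^ n ≤ 2 ^ (n + 1))
    rwa [hsucc, mul_div_cancel_right₀ _ (hpos n).ne', ENNReal.ofReal_ofNat, ← hsucc] at this
  have hx₀ (n : ℤ) : ‖x₀ n‖ₑ ≤ 2 * C.K (2 ^ n) a := le_self_add.trans (hle n)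
  have hx₁ (n : ℤ) : ENNReal.ofReal (2 ^ n) * ‖x₁ n‖ₑ ≤ 2 * C.K (2 ^ n) a :=
    le_add_self.trans (hle n)
  -- Two decompositions of the same `a` differ by an element of the intersection: `x₀(n+1) - x₀(n) =
  -- x₁(n) - x₁(n+1)`.
  let V : ℤ → C.interSpace := fun n => ⟨(x₀ (n + 1) - x₀ n, x₁ n - x₁ (n + 1)), by
    have h := congrArg C.toZ ((hx n).symm.trans (hx (n + 1)))
    simp only [map_add, toZ_inl, toZ_inr] at h
    rw [mem_interSpace, map_sub, map_sub, sub_eq_sub_iff_add_eq_add, ← h, add_comm]⟩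
  have hV₀ (n : ℤ) : ‖(V n : X₀ × X₁).1‖ₑ ≤ 8 * C.K (2 ^ n) a := by
    calc _ ≤ ‖x₀ (n + 1)‖ₑ + ‖x₀ n‖ₑ := enorm_sub_le
      _ ≤ 2 * (2 * C.K (2 ^ n) a) + 2 * C.K (2 ^ n) a := by
          gcongr
          · exact (hx₀ _).trans (by gcongr; exact hK2 n)
          · exact hx₀ n
      _ = 6 * C.K (2 ^ n) a := by ring
      _ ≤ _ := by gcongr; norm_num
  -- The weight is `2^(n+1)`, not `2^n`, because it must dominate every `r` of the block on which
  -- `v` uses `V n`.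
  have hV₁ (n : ℤ) : ENNReal.ofReal (2 ^ (n + 1)) * ‖(V n : X₀ × X₁).2‖ₑ ≤
      8 * C.K (2 ^ n) a := by
    calc _ ≤ ENNReal.ofReal (2 ^ (n + 1)) * (‖x₁ n‖ₑ + ‖x₁ (n + 1)‖ₑ) := by
          gcongr; exact enorm_sub_le
      _ = 2 * (ENNReal.ofReal (2 ^ n) * ‖x₁ n‖ₑ) +
          ENNReal.ofReal (2 ^ (n + 1)) * ‖x₁ (n + 1)‖ₑ := by
          rw [mul_add, hsucc, ENNReal.ofReal_mul zero_le_two, ENNReal.ofReal_ofNat, mul_assoc]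
      _ ≤ 2 * (2 * C.K (2 ^ n) a) + 2 * (2 * C.K (2 ^ n) a) := by
          gcongr 2 * ?_ + ?_
          · exact hx₁ n
          · exact (hx₁ _).trans (by gcongr; exact hK2 n)
      _ = _ := by ring
  have hlog : 0 < Real.log 2 := Real.log_pos one_lt_two
  have hc : ‖(Real.log 2)⁻¹‖ₑ ≤ 2 := by
    rw [Real.enorm_of_nonneg (by positivity), ← ENNReal.ofReal_ofNat 2]
    gcongr
    rw [inv_le_comm₀ hlog two_pos]
    linarith [Real.log_two_gt_d9]
  -- Each block has `dr/r`-mass `log 2`, so this normalization makes the block integral equal to `V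
  -- n`. As `1/log 2 ≤ 2`, the bound 8 becomes 16.
  let v : ℝ → C.interSpace := fun r => (Real.log 2)⁻¹ • V ⌊Real.logb 2 r⌋
  have hvm : StronglyMeasurable v := by
    have h1 : Measurable fun r : ℝ => ⌊Real.logb 2 r⌋ :=
      Int.measurable_floor.comp (by unfold Real.logb; fun_prop)
    exact ((StronglyMeasurable.of_discrete (f := V)).comp_measurable h1).const_smul (Real.log 2)⁻¹
  have hJ (r : ℝ) (hr : 0 < r) : C.J r (v r) ≤ 16 * C.K r a := by
    obtain ⟨hn1, hn2⟩ := (floor_logb_two_eq_iff hr _).1 rfl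
    set n := ⌊Real.logb 2 r⌋
    have hKr : 8 * C.K (2 ^ n) a ≤ 8 * C.K r a := by gcongr; exact hK.monotone hn1
    refine max_le ?_ ?_
    · calc ‖(Real.log 2)⁻¹ • (V n : X₀ × X₁).1‖ₑ ≤ 2 * (8 * C.K r a) := by
            rw [enorm_smul]; gcongr; exact (hV₀ n).trans hKr
        _ = _ := by ring
    · calc ENNReal.ofReal r * ‖(Real.log 2)⁻¹ • (V n : X₀ × X₁).2‖ₑ
          = ‖(Real.log 2)⁻¹‖ₑ * (ENNReal.ofReal r * ‖(V n : X₀ × X₁).2‖ₑ) := by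
            rw [enorm_smul]; ring
        _ ≤ 2 * (8 * C.K r a) := by
            gcongr ?_ * ?_
            refine le_trans ?_ ((hV₁ n).trans hKr)
            gcongr
        _ = _ := by ring
  have hint : IntegrableOn (fun t : ℝ => t⁻¹ • C.ofInter (v t)) (Ioi 0) := by
    refine ⟨(measurable_inv.stronglyMeasurable.smul
      (C.continuous_ofInter.comp_stronglyMeasurable hvm)).aestronglyMeasurable, ?_⟩
    rw [hasFiniteIntegral_iff_enorm]
    refine lt_of_le_of_lt ?_ (ENNReal.mul_lt_top (ENNReal.ofNat_lt_top (n := 16)) hfin.lt_top)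
    rw [← lintegral_const_mul' _ _ (by simp)]
    refine setLIntegral_mono' measurableSet_Ioi fun r hr => ?_
    have hr : 0 < r := hr
    rw [enorm_smul, Real.enorm_of_nonneg (by positivity)]
    calc _ ≤ ENNReal.ofReal r⁻¹ * (ENNReal.ofReal (min 1 r⁻¹) * (16 * C.K r a)) := by
          gcongr
          exact (C.enorm_ofInter_le hr _).trans (by gcongr; exact hJ r hr)
      _ = _ := by ring
  refine ⟨v, hvm, ⟨hvm.aestronglyMeasurable, hint, ?_⟩, hJ⟩
  have hsum := hasSum_integral_iUnion (fun _ : ℤ => measurableSet_Ico)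
    pairwise_disjoint_Ico_two_zpow (by rwa [iUnion_Ico_two_zpow])
  rw [iUnion_Ico_two_zpow] at hsum
  have hterm (n : ℤ) : ∫ t in Ico ((2 : ℝ) ^ n) (2 ^ (n + 1)), t⁻¹ • C.ofInter (v t) =
      C.inl (x₀ (n + 1)) - C.inl (x₀ n) := by
    calc _ = ∫ t in Ico ((2 : ℝ) ^ n) (2 ^ (n + 1)),
          t⁻¹ • ((Real.log 2)⁻¹ • (C.inl (x₀ (n + 1)) - C.inl (x₀ n))) := by
          refine setIntegral_congr_fun measurableSet_Ico fun t ht => ?_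
          have ht0 : 0 < t := (hpos n).trans_le ht.1
          dsimp only [v]
          rw [(floor_logb_two_eq_iff ht0 n).2 ht, map_smul, ofInter_eq_inl, ← map_sub]
      _ = _ := by
          rw [integral_smul_const, setIntegral_inv_Ico_two_zpow, smul_smul,
            mul_inv_cancel₀ hlog.ne', one_smul]
  simp only [hterm] at hsum
  have hlim := hsum.nat_add_neg_add_one.tendsto_sum_nat
  -- Pairing `n` with `-(n+1)` telescopes to `x₀(N) - x₀(-N)`, and `x₀(N) = a - x₁(N)` in the sum
  -- space. The two remainders vanish by the decay of `K(2^n, a)` at `0` and of `2^{-n} K(2^n, a)`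
  -- at `∞`.
  have htel (N : ℕ) : ∑ n ∈ Finset.range N, (C.inl (x₀ ((n : ℤ) + 1)) - C.inl (x₀ n) +
      (C.inl (x₀ (-((n : ℤ) + 1) + 1)) - C.inl (x₀ (-((n : ℤ) + 1))))) =
      a - C.inr (x₁ N) - C.inl (x₀ (-(N : ℤ))) := by
    have hN := hx N
    have := Finset.sum_range_sub (fun n : ℕ => C.inl (x₀ n) - C.inl (x₀ (-(n : ℤ)))) N
    calc _ = _ := Finset.sum_congr rfl fun n _ => ?_
      _ = _ := this
      _ = _ := ?_
    · push_cast
      rw [show -((n : ℤ) + 1) + 1 = -n by ring]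
      abel
    · rw [eq_sub_of_add_eq hN.symm]
      simp only [Nat.cast_zero, neg_zero, sub_self, sub_zero]
  simp only [htel] at hlim
  have hc0 := hK.tendsto_two_zpow hfin
  have hc2 : Filter.Tendsto (fun n : ℤ => 2 * (ENNReal.ofReal (min 1 ((2 : ℝ) ^ n)⁻¹) *
      C.K (2 ^ n) a)) Filter.cofinite (nhds 0) := by
    simpa using ENNReal.Tendsto.const_mul hc0 (Or.inr (ENNReal.ofNat_ne_top (n := 2)))
  have hNpos : Filter.Tendsto (fun N : ℕ => (N : ℤ)) Filter.atTop Filter.cofinite := by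
    rw [← Nat.cofinite_eq_atTop]
    exact Nat.cast_injective.tendsto_cofinite
  have hNneg : Filter.Tendsto (fun N : ℕ => -(N : ℤ)) Filter.atTop Filter.cofinite := by
    rw [← Nat.cofinite_eq_atTop]
    exact (neg_injective.comp Nat.cast_injective).tendsto_cofinite
  have hl₁ : Filter.Tendsto (fun N : ℕ => C.inr (x₁ N)) Filter.atTop (nhds 0) := by
    rw [tendsto_zero_iff_enorm_tendsto_zero]
    refine tendsto_of_tendsto_of_tendsto_of_le_of_le tendsto_const_nhds (hc2.comp hNpos)
      (fun _ => zero_le) fun N => (C.enorm_inr_le _).trans ?_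
    have h1 : (1 : ℝ) ≤ 2 ^ (N : ℤ) := one_le_zpow₀ one_le_two (by positivity)
    simp only [Function.comp_apply]
    rw [min_eq_right (inv_le_one_of_one_le₀ h1)]
    calc _ = ENNReal.ofReal (2 ^ (N : ℤ))⁻¹ * (ENNReal.ofReal (2 ^ (N : ℤ)) * ‖x₁ N‖ₑ) := by
          rw [← mul_assoc, ← ENNReal.ofReal_mul (by positivity),
            inv_mul_cancel₀ (hpos N).ne', ENNReal.ofReal_one, one_mul]
      _ ≤ ENNReal.ofReal (2 ^ (N : ℤ))⁻¹ * (2 * C.K (2 ^ (N : ℤ)) a) := by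
          gcongr _ * ?_; exact hx₁ N
      _ = _ := by ring
  have hl₀ : Filter.Tendsto (fun N : ℕ => C.inl (x₀ (-(N : ℤ)))) Filter.atTop (nhds 0) := by
    rw [tendsto_zero_iff_enorm_tendsto_zero]
    refine tendsto_of_tendsto_of_tendsto_of_le_of_le tendsto_const_nhds (hc2.comp hNneg)
      (fun _ => zero_le) fun N => (C.enorm_inl_le _).trans ?_
    have h1 : (1 : ℝ) ≤ 2 ^ (N : ℤ) := one_le_zpow₀ one_le_two (by positivity)
    simp only [Function.comp_apply]
    rw [zpow_neg, inv_inv, min_eq_left h1, ENNReal.ofReal_one, one_mul, ← zpow_neg]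
    exact hx₀ _
  have hlim' := (tendsto_const_nhds (x := a)).sub hl₁ |>.sub hl₀
  rw [sub_zero, sub_zero] at hlim'
  exact tendsto_nhds_unique hlim' hlim

end Topology

end InterpolationCouple

/-! ### Transferring pointwise bounds to norms, and the kernel integral -/

theorem interpFunctional_le_mul {φ : ℝ → ℝ≥0∞} {p : ℝ} (hp : 0 < p) {c : ℝ≥0∞} (hc : c ≠ ∞)
    {F G : ℝ → ℝ≥0∞} (h : ∀ r, 0 < r → F r ≤ c * G r) :
    interpFunctional φ p F ≤ c * interpFunctional φ p G := by
  have hp1 : 0 ≤ 1 / p := by positivity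
  calc interpFunctional φ p F ≤
        (∫⁻ t in Ioi (0 : ℝ), c ^ p * ((φ t⁻¹ * G t) ^ p * ENNReal.ofReal t⁻¹)) ^ (1 / p) := by
        refine ENNReal.rpow_le_rpow (setLIntegral_mono' measurableSet_Ioi fun r hr => ?_) hp1
        rw [← mul_assoc, ← ENNReal.mul_rpow_of_nonneg _ _ hp.le, mul_left_comm]
        gcongr
        exact h r hr
    _ = _ := by
        rw [lintegral_const_mul' _ _ (ENNReal.rpow_ne_top_of_nonneg hp.le hc),
          ENNReal.mul_rpow_of_nonneg _ _ hp1, ← ENNReal.rpow_mul, mul_one_div_cancel hp.ne',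
          ENNReal.rpow_one, interpFunctional]

theorem eLpNorm_le_of_enorm_le_mul {α E : Type*} [MeasurableSpace α] [NormedAddCommGroup E]
    {μ : Measure α} {p : ℝ} (hp : 0 < p) {c : ℝ≥0∞} {F : α → E} {B : α → ℝ≥0∞}
    (hB : Measurable B) (h : ∀ t, ‖F t‖ₑ ≤ c * B t) :
    eLpNorm F (ENNReal.ofReal p) μ ≤ c * (∫⁻ t, B t ^ p ∂μ) ^ (1 / p) := by
  have hp1 : 0 ≤ 1 / p := by positivity
  rw [eLpNorm_eq_lintegral_rpow_enorm_toReal (by simpa using hp) ENNReal.ofReal_ne_top,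
    ENNReal.toReal_ofReal hp.le]
  calc _ ≤ (∫⁻ t, c ^ p * B t ^ p ∂μ) ^ (1 / p) := by
        gcongr with t
        rw [← ENNReal.mul_rpow_of_nonneg _ _ hp.le]
        gcongr
        exact h t
    _ = _ := by
        rw [lintegral_const_mul _ (by fun_prop), ENNReal.mul_rpow_of_nonneg _ _ hp1,
          ← ENNReal.rpow_mul, mul_one_div_cancel hp.ne', ENNReal.rpow_one]

theorem setIntegral_neg_exp_neg_mul {t r : ℝ} (ht : 0 ≤ t) (hr : 0 < r) :
    ∫ s in Ioc 0 t, -Real.exp (-(s * r)) = Real.exp (-(t * r)) * r⁻¹ - r⁻¹ := by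
  rw [← intervalIntegral.integral_of_le ht]
  have hd : ∀ s ∈ uIcc 0 t, HasDerivAt (fun s => Real.exp (-(s * r)) * r⁻¹)
      (-Real.exp (-(s * r))) s := fun s _ => by
    have := (((hasDerivAt_id s).mul_const r).neg.exp).mul_const r⁻¹
    exact this.congr_deriv (by simp [hr.ne'])
  rw [intervalIntegral.integral_eq_sub_of_hasDerivAt hd
    (by apply Continuous.intervalIntegrable; fun_prop)]
  simp

end

/-! ### The extension and its derivative -/

theorem theorem1p3 (p : ℝ) (hp : 1 < p) :
    ∃ N : ℝ≥0∞ → ℝ≥0,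
      ∀ (X₀ X₁ Z : Type*)
        [NormedAddCommGroup X₀] [NormedSpace ℝ X₀] [CompleteSpace X₀]
        [NormedAddCommGroup X₁] [NormedSpace ℝ X₁] [CompleteSpace X₁]
        [AddCommGroup Z] [Module ℝ Z] [TopologicalSpace Z] [IsTopologicalAddGroup Z]
        [ContinuousSMul ℝ Z] [T2Space Z]
        (C : InterpolationCouple X₀ X₁ Z)
        (w : ℝ → ℝ≥0) (_ : IsMuckenhoupt p w)
        (a : C.SumSpace)
        (_ : a ∈ C.interpSpace (fun t => weightPrimitive w t ^ (1 / p)) p),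
        -- `u : [0,∞) → X₀ + X₁`, which on `(0,∞)` is the `X₀`-valued function `u₀`
        ∃ (u : ℝ → C.SumSpace) (u₀ : ℝ → X₀) (f : ℝ → X₁) (v : ℝ → C.interSpace),
          (∀ t, 0 < t → u t = C.inl (u₀ t)) ∧
          MemLp u₀ (ENNReal.ofReal p) (weightMeasure w) ∧
          MemLp f (ENNReal.ofReal p) (weightMeasure w) ∧
          u 0 = a ∧
          (∀ t, 0 < t → IntegrableOn f (Ioc 0 t) ∧
            u t = a + C.inr (∫ s in Ioc 0 t, f s)) ∧
          eLpNorm u₀ (ENNReal.ofReal p) (weightMeasure w) +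
              eLpNorm f (ENNReal.ofReal p) (weightMeasure w) ≤
            N (muckenhouptConst p w) *
              C.interpNorm (fun t => weightPrimitive w t ^ (1 / p)) p a ∧
          -- the form of `u`
          C.IsJRepresentation v a ∧
          interpFunctional (fun t => weightPrimitive w t ^ (1 / p)) p (fun r => C.J r (v r)) ≤
            N (muckenhouptConst p w) *
              C.interpNorm (fun t => weightPrimitive w t ^ (1 / p)) p a ∧
          (∀ t, 0 ≤ t →
            IntegrableOn (fun r : ℝ => (Real.exp (-(t * r)) * r⁻¹) • C.ofInter (v r)) (Ioi 0) ∧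
            u t = ∫ r in Ioi (0 : ℝ), (Real.exp (-(t * r)) * r⁻¹) • C.ofInter (v r)) := by
  have hp0 : 0 < p := by linarith
  -- `16` times the Laplace bound for each of `u` and `f` gives 32; the summand 16 serves the bound
  -- on `J(·, v)`.
  refine ⟨fun q => (32 * laplaceConst p q + 16).toNNReal, ?_⟩
  intro X₀ X₁ Z _ _ _ _ _ _ _ _ _ _ _ _ C w hw a ha
  have hq : muckenhouptConst p w ≠ ∞ := hw.const_lt_top.ne
  set N := 32 * laplaceConst p (muckenhouptConst p w) + 16
  have hNtop : N ≠ ∞ := by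
    have := laplaceConst_ne_top hp hq
    finiteness
  rw [ENNReal.coe_toNNReal hNtop]
  set A := C.interpNorm (fun t => weightPrimitive w t ^ (1 / p)) p a with hA
  have hAtop : A ≠ ∞ := ne_of_lt ha
  have hK := C.isQuasiconcave_K a
  have hKm : Measurable fun t => C.K t a := hK.monotone.measurable
  have hB (T : ℝ) (hT : 0 < T) := hK.setLIntegral_laplaceLog_ne_top hp hw hAtop hT
  obtain ⟨v, hvm, hv, hJ⟩ :=
    C.exists_isJRepresentation a (lintegral_min_mul_ne_top hKm (hB 1 one_pos))
  have hx₀ (r : ℝ) (hr : 0 < r) : ‖(v r : X₀ × X₁).1‖ₑ ≤ 16 * C.K r a :=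
    (le_max_left _ _).trans (hJ r hr)
  have hx₁ (r : ℝ) (hr : 0 < r) : ‖(v r : X₀ × X₁).2‖ₑ ≤ 16 * (C.K r a * ENNReal.ofReal r⁻¹) := by
    calc _ = ENNReal.ofReal r⁻¹ * (ENNReal.ofReal r * ‖(v r : X₀ × X₁).2‖ₑ) := by
          rw [← mul_assoc, ← ENNReal.ofReal_mul (by positivity), inv_mul_cancel₀ hr.ne',
            ENNReal.ofReal_one, one_mul]
      _ ≤ ENNReal.ofReal r⁻¹ * (16 * C.K r a) := by
          gcongr _ * ?_
          exact (le_max_right _ _).trans (hJ r hr)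
      _ = _ := by ring
  have hm₀ : StronglyMeasurable fun r => (v r : X₀ × X₁).1 :=
    (continuous_fst.comp continuous_subtype_val).comp_stronglyMeasurable hvm
  have hm₁ : StronglyMeasurable fun r => (v r : X₀ × X₁).2 :=
    (continuous_snd.comp continuous_subtype_val).comp_stronglyMeasurable hvm
  -- `g₀` is the integrand of `u` read in `X₀`, and `g₁` its `t`-derivative read in `X₁`, where the
  -- factor `1/r` has cancelled.
  let g₀ : ℝ → ℝ → X₀ := fun t r => (Real.exp (-(t * r)) * r⁻¹) • (v r : X₀ × X₁).1
  let g₁ : ℝ → ℝ → X₁ := fun t r => (-Real.exp (-(t * r))) • (v r : X₀ × X₁).2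
  have hg₀m : StronglyMeasurable (Function.uncurry g₀) :=
    (by fun_prop : Measurable fun x : ℝ × ℝ =>
      Real.exp (-(x.1 * x.2)) * x.2⁻¹).stronglyMeasurable.smul (hm₀.comp_measurable measurable_snd)
  have hg₁m : StronglyMeasurable (Function.uncurry g₁) :=
    (by fun_prop : Measurable fun x : ℝ × ℝ =>
      -Real.exp (-(x.1 * x.2))).stronglyMeasurable.smul (hm₁.comp_measurable measurable_snd)
  have hg₀ (t : ℝ) : ∫⁻ r in Ioi (0 : ℝ), ‖g₀ t r‖ₑ ≤ 16 * laplaceLog (fun r => C.K r a) t := by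
    rw [laplaceLog, ← lintegral_const_mul' _ _ (by simp)]
    refine setLIntegral_mono' measurableSet_Ioi fun r hr => ?_
    have hr : 0 < r := hr
    rw [enorm_smul, Real.enorm_of_nonneg (by positivity), ENNReal.ofReal_mul (by positivity)]
    calc _ ≤ ENNReal.ofReal (Real.exp (-(t * r))) * ENNReal.ofReal r⁻¹ * (16 * C.K r a) := by
          gcongr _ * ?_
          exact hx₀ r hr
      _ = _ := by ring
  have hg₁ (t : ℝ) : ∫⁻ r in Ioi (0 : ℝ), ‖g₁ t r‖ₑ ≤ 16 * laplaceLog (fun r => C.K r a) t := by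
    rw [laplaceLog, ← lintegral_const_mul' _ _ (by simp)]
    refine setLIntegral_mono' measurableSet_Ioi fun r hr => ?_
    rw [enorm_smul, enorm_neg, Real.enorm_of_nonneg (by positivity)]
    calc _ ≤ ENNReal.ofReal (Real.exp (-(t * r))) *
          (16 * (C.K r a * ENNReal.ofReal r⁻¹)) := by
          gcongr _ * ?_
          exact hx₁ r hr
      _ = _ := by ring
  let u₀ : ℝ → X₀ := fun t => ∫ r in Ioi (0 : ℝ), g₀ t r
  let f : ℝ → X₁ := fun t => ∫ r in Ioi (0 : ℝ), g₁ t r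
  have hu₀m : StronglyMeasurable u₀ := hg₀m.integral_prod_right
  have hfm : StronglyMeasurable f := hg₁m.integral_prod_right
  -- Valid for every real `t`: where the integral diverges the Bochner integral is 0.
  have hu₀ (t : ℝ) : ‖u₀ t‖ₑ ≤ 16 * laplaceLog (fun r => C.K r a) t :=
    (enorm_integral_le_lintegral_enorm _).trans (hg₀ t)
  have hf (t : ℝ) : ‖f t‖ₑ ≤ 16 * laplaceLog (fun r => C.K r a) t :=
    (enorm_integral_le_lintegral_enorm _).trans (hg₁ t)
  have hLp := hK.lintegral_laplaceLog_rpow_le hp hw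
  have hu₀p := (eLpNorm_le_of_enorm_le_mul hp0 (antitone_laplaceLog _).measurable hu₀).trans
    (mul_le_mul_right hLp 16)
  have hfp := (eLpNorm_le_of_enorm_le_mul hp0 (antitone_laplaceLog _).measurable hf).trans
    (mul_le_mul_right hLp 16)
  have hLtop : 16 * (laplaceConst p (muckenhouptConst p w) * A) < ∞ := by
    have := laplaceConst_ne_top hp hq
    finiteness
  have hint (t : ℝ) (ht : 0 ≤ t) :
      IntegrableOn (fun r : ℝ => (Real.exp (-(t * r)) * r⁻¹) • C.ofInter (v r)) (Ioi 0) := by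
    refine Integrable.mono hv.integrableOn ((by fun_prop : Measurable fun r : ℝ =>
      Real.exp (-(t * r)) * r⁻¹).stronglyMeasurable.smul
        (C.continuous_ofInter.comp_stronglyMeasurable hvm)).aestronglyMeasurable ?_
    filter_upwards [ae_restrict_mem measurableSet_Ioi] with r hr
    have hr : 0 < r := hr
    rw [mul_smul, norm_smul, Real.norm_of_nonneg (by positivity)]
    refine mul_le_of_le_one_left (norm_nonneg _) ?_
    rw [Real.exp_le_one_iff]
    have := mul_nonneg ht hr.le
    linarith
  refine ⟨fun t => ∫ r in Ioi (0 : ℝ), (Real.exp (-(t * r)) * r⁻¹) • C.ofInter (v r), u₀, f, v,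
    ?_, ⟨hu₀m.aestronglyMeasurable, hu₀p.trans_lt hLtop⟩,
    ⟨hfm.aestronglyMeasurable, hfp.trans_lt hLtop⟩, ?_, ?_, ?_, hv, ?_,
    fun t ht => ⟨hint t ht, rfl⟩⟩
  · intro t ht
    have hgi : IntegrableOn (g₀ t) (Ioi 0) := by
      refine ⟨(hg₀m.comp_measurable measurable_prodMk_left).aestronglyMeasurable, ?_⟩
      rw [hasFiniteIntegral_iff_enorm]
      exact (hg₀ t).trans_lt (ENNReal.mul_lt_top (by simp)
        (laplaceLog_ne_top_of_setLIntegral ht (hB t ht)).lt_top)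
    rw [← C.inlL_apply, ← C.inlL.integral_comp_comm hgi]
    simp only [g₀, map_smul, C.inlL_apply, C.ofInter_eq_inl]
  · simpa using hv.integral_eq.symm
  · intro t ht
    -- Fubini takes place in `X₁`, where integrability of `B` on `(0,t]` dominates. Integrating in
    -- `s` first gives `(e^{-tr} - 1)/r` times `v(r)`, whose integral over `r` is `u(t) - a` in the
    -- sum space.
    have hprod : Integrable (Function.uncurry g₁)
        ((volume.restrict (Ioc 0 t)).prod (volume.restrict (Ioi 0))) := by
      refine ⟨hg₁m.aestronglyMeasurable, ?_⟩
      rw [hasFiniteIntegral_iff_enorm, lintegral_prod _ hg₁m.enorm.aemeasurable]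
      calc _ ≤ ∫⁻ s in Ioc 0 t, 16 * laplaceLog (fun r => C.K r a) s := lintegral_mono hg₁
        _ = 16 * ∫⁻ s in Ioc 0 t, laplaceLog (fun r => C.K r a) s :=
            lintegral_const_mul' _ _ (by simp)
        _ < ∞ := ENNReal.mul_lt_top (by simp) (hB t ht).lt_top
    refine ⟨hprod.integral_prod_left, ?_⟩
    have hinner (r : ℝ) (hr : 0 < r) : ∫ s in Ioc 0 t, g₁ s r =
        (Real.exp (-(t * r)) * r⁻¹ - r⁻¹) • (v r : X₀ × X₁).2 := by
      simp only [g₁]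
      rw [integral_smul_const, setIntegral_neg_exp_neg_mul ht.le hr]
    have hswap : ∫ s in Ioc 0 t, f s = ∫ r in Ioi (0 : ℝ),
        (Real.exp (-(t * r)) * r⁻¹ - r⁻¹) • (v r : X₀ × X₁).2 := by
      rw [integral_integral_swap hprod]
      exact setIntegral_congr_fun measurableSet_Ioi hinner
    have hri : IntegrableOn (fun r : ℝ =>
        (Real.exp (-(t * r)) * r⁻¹ - r⁻¹) • (v r : X₀ × X₁).2) (Ioi 0) :=
      (integrableOn_congr_fun hinner measurableSet_Ioi).1 hprod.integral_prod_right
    rw [hswap, ← C.inrL_apply, ← C.inrL.integral_comp_comm hri]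
    conv_rhs => enter [1]; rw [hv.integral_eq]
    rw [← sub_eq_iff_eq_add', ← integral_sub (hint t ht.le) hv.integrableOn]
    simp only [map_sub, map_smul, C.inrL_apply, C.ofInter_eq_inr, sub_smul]
  · calc _ ≤ 16 * (laplaceConst p (muckenhouptConst p w) * A) +
          16 * (laplaceConst p (muckenhouptConst p w) * A) := add_le_add hu₀p hfp
      _ = 32 * laplaceConst p (muckenhouptConst p w) * A := by ring
      _ ≤ _ := by
          gcongr
          exact le_self_add
  · refine (interpFunctional_le_mul hp0 (by simp) hJ).trans ?_
    gcongr
    exacts [le_add_self, le_rfl]
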